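/- Setting. Let $n\ge 2$, $\tau\ge 1$ be integers, $0<\mu$, $L>0$, and let $f:\mathbb R^n\to\mathbb R$ be twice differentiable with $\mu I\preceq\nabla^2 f(x)\preceq\omega I$ and $\|\nabla^2 f(y)-\nabla^2 f(x)\|\le L\|y-x\|$ for all $x,y$. Put $\kappa=\omega/\mu$, and let $0<M\le L/\mu^{3/2}$ be a constant of strong self-concordance of $f$: $\nabla^2 f(y)-\nabla^2 f(x)\preceq M\|y-x\|_{\nabla^2 f(z)}\nabla^2 f(w)$ for all $x,y,z,w$, where $\|h\|_A=\langle Ah,h\rangle^{1/2}$ and $\|h\|_A^*=\langle A^{-1}h,h\rangle^{1/2}$. For $G\succeq A\succ0$ let $\sigma_A(G)=\operatorname{tr}(A^{-1}(G-A))$, $$\mathrm{SR1}(G,A,u)=G-\frac{(G-A)uu^{\mathsf T}(G-A)}{\langle (G-A)u,u\rangle},$$ $$\mathrm{DFP}(G,A,u)=G-\frac{Auu^{\mathsf T}G+Guu^{\mathsf T}A}{\langle Au,u\rangle}+\Big(\frac{\langle Gu,u\rangle}{\langle Au,u\rangle}+1\Big)\frac{Auu^{\mathsf T}A}{\langle Au,u\rangle}$$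 (with $\mathrm{SR1}(G,A,u)=G$ if $Gu=Au$), and let $\mathrm{gBroyd}(G,A)=\phi\,\mathrm{DFP}(G,A,u)+(1-\phi)\,\mathrm{SR1}(G,A,u)$, where $u\in\{e_1,\dots,e_n\}$ is any maximizer of $\langle Gu,u\rangle/\langle Au,u\rangle$ and $\phi\in[0,1]$ is arbitrary at every call. Let $$\varepsilon_0=\frac1{2\kappa-1},\quad \rho=1-\frac1{n\kappa},\quad \sigma_\tau=\rho^\tau\varepsilon_0+n,\quad \bar\Phi_0=\varepsilon_0+\frac{n\ln 2}{12n+2},$$ $$c_\tau=-\frac{\sigma_\tau}{\sigma_\tau+n}+\frac{\sqrt{\rho\sigma_\tau^2+(\sigma_\tau+n)(1-\rho^{\tau+1})\varepsilon_0}}{\sqrt\rho\,(\sigma_\tau+n)},\qquad \beta(x)=\frac{L\|\nabla f(x)\|}{2\mu^2}.$$ The adaptive greedy quasi-Newton method (AGQN) started at $(x^0,G^0)$ iterates, for $k\ge0$, $$x^{k+1}=x^k-\alpha^k(G^k)^{-1}\nabla f(x^k),\qquad \alpha^k=\min\Big\{\frac{c_\tau}{M\|\nabla f(x^k)\|^*_{G^k}},\frac1{4\beta(x^k)},1\Big\},$$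 $$G^{k+1}=\mathrm{gBroyd}\big((1+Mr^{k+1})\underline G^k,\nabla^2 f(x^{k+1})\big),\qquad r^{k+1}=\|x^{k+1}-x^k\|_{\nabla^2 f(x^k)},$$ where $\underline G^k$ results from $\tau$ successive updates $\mathrm{gBroyd}(\cdot,\nabla^2 f(x^k))$ started at $G^k$ (a stationary point is kept fixed). Claim. There is an absolute constant $C>0$ such that, for all such data, if $G^0\succeq\nabla^2 f(x^0)$ and $\sigma_{\nabla^2 f(x^0)}(G^0)\le\varepsilon_0$, then for every run of the AGQN the following hold. (1) For every $\epsilon>0$ with $\epsilon\le\bar\Phi_0/2$ and $\epsilon\,\|\nabla f(x^0)\|\le\bar\Phi_0^2$ (that is, for all sufficiently small $\epsilon$), some iterate $x^k$ with $$k\le C\,\frac{nL(\kappa n+\tau)\kappa}{\mu^2\tau}\|\nabla f(x^0)\|+C\sqrt{\min\{4n\kappa/3,\;n\kappa+\tau\}}\,\sqrt{\log(\bar\Phi_0/\epsilon)}$$ satisfies $\|\nabla f(x^k)\|\le\epsilon$. (2) For every $\epsilon>0$, the same is true with $\log(\bar\Phi_0/\epsilon)$ replaced by $\max\{\log 2,\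 \log(\bar\Phi_0/\epsilon),\ \log(\|\nabla f(x^0)\|/\bar\Phi_0)\}$ (the last entry is omitted if $\nabla f(x^0)=0$), which equals $\log(\bar\Phi_0/\epsilon)$ for $\epsilon$ as in (1). -/

import Mathlib

open scoped Matrix

namespace AGQN

noncomputable section

/-- The Hessian matrix of `f` at `x` in the standard basis: the matrix of the derivative of the
gradient of `f` at `x`. -/
def hessian {n : ℕ} (f : EuclideanSpace ℝ (Fin n) → ℝ) (x : EuclideanSpace ℝ (Fin n)) :
    Matrix (Fin n) (Fin n) ℝ :=
  (Matrix.toEuclideanCLM (n := Fin n) (𝕜 := ℝ)).symm (fderiv ℝ (gradient f) x)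

/-- The order `A ⪯ B`: the matrix `B - A` is (symmetric) positive semidefinite. -/
def Loewner {n : ℕ} (A B : Matrix (Fin n) (Fin n) ℝ) : Prop :=
  (B - A).PosSemidef

/-- `‖h‖_A = ⟨A h, h⟩ ^ (1/2)`. -/
def normAt {n : ℕ} (A : Matrix (Fin n) (Fin n) ℝ) (h : EuclideanSpace ℝ (Fin n)) : ℝ :=
  Real.sqrt ((A *ᵥ h.ofLp) ⬝ᵥ h.ofLp)

/-- `‖h‖_A^* = ⟨A⁻¹ h, h⟩ ^ (1/2)`. -/
def dualNormAt {n : ℕ} (A : Matrix (Fin n) (Fin n) ℝ) (h : EuclideanSpace ℝ (Fin n)) : ℝ :=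
  Real.sqrt ((A⁻¹ *ᵥ h.ofLp) ⬝ᵥ h.ofLp)

/-- The standing assumption on the objective: `f` is twice differentiable,
`μ I ⪯ ∇²f(x) ⪯ ω I` for all `x` (with `μ > 0`), and `∇²f` is `L`-Lipschitz for the
operator norm induced by the Euclidean norm (with `L > 0`). -/
structure Assumption {n : ℕ} (f : EuclideanSpace ℝ (Fin n) → ℝ) (μ ω L : ℝ) : Prop where
  differentiable : Differentiable ℝ f
  differentiable_gradient : Differentiable ℝ (gradient f)
  mu_pos : 0 < μ
  L_pos : 0 < L
  lower : ∀ x, Loewner (μ • (1 : Matrix (Fin n) (Fin n) ℝ)) (hessian f x)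
  upper : ∀ x, Loewner (hessian f x) (ω • (1 : Matrix (Fin n) (Fin n) ℝ))
  lipschitz : ∀ x y,
    ‖fderiv ℝ (gradient f) y - fderiv ℝ (gradient f) x‖ ≤ L * ‖y - x‖

/-- Strong self-concordance with constant `M`:
`∇²f(y) - ∇²f(x) ⪯ M ‖y - x‖_{∇²f(z)} ∇²f(w)` for all `x, y, z, w`. -/
def StronglySelfConcordant {n : ℕ} (f : EuclideanSpace ℝ (Fin n) → ℝ) (M : ℝ) : Prop :=
  ∀ x y z w, Loewner (hessian f y - hessian f x)
    ((M * normAt (hessian f z) (y - x)) • hessian f w)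

/-! ### Greedy quasi-Newton updates -/

/-- The SR1 update. If `(G - A) u = 0` the value is `G`. -/
def sr1 {n : ℕ} (G A : Matrix (Fin n) (Fin n) ℝ) (u : Fin n → ℝ) : Matrix (Fin n) (Fin n) ℝ :=
  G - (1 / (((G - A) *ᵥ u) ⬝ᵥ u)) • ((G - A) * Matrix.vecMulVec u u * (G - A))

/-- The DFP update. -/
def dfp {n : ℕ} (G A : Matrix (Fin n) (Fin n) ℝ) (u : Fin n → ℝ) : Matrix (Fin n) (Fin n) ℝ :=
  G - (1 / ((A *ᵥ u) ⬝ᵥ u)) •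
      (A * Matrix.vecMulVec u u * G + G * Matrix.vecMulVec u u * A)
    + ((((G *ᵥ u) ⬝ᵥ u) / ((A *ᵥ u) ⬝ᵥ u) + 1) / ((A *ᵥ u) ⬝ᵥ u)) •
      (A * Matrix.vecMulVec u u * A)

/-- The member of the Broyden family with parameter `φ`. -/
def broyd {n : ℕ} (φ : ℝ) (G A : Matrix (Fin n) (Fin n) ℝ) (u : Fin n → ℝ) :
    Matrix (Fin n) (Fin n) ℝ :=
  φ • dfp G A u + (1 - φ) • sr1 G A u

/-- The quotient `⟨G e_i, e_i⟩ / ⟨A e_i, e_i⟩` for the standard unit vector `e_i`. -/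
def greedyQuotient {n : ℕ} (G A : Matrix (Fin n) (Fin n) ℝ) (i : Fin n) : ℝ :=
  ((G *ᵥ Pi.single i 1) ⬝ᵥ Pi.single i 1) / ((A *ᵥ Pi.single i 1) ⬝ᵥ Pi.single i 1)

/-- `G'` is a possible result of one greedy Broyden update `gBroyd(G, A)`: the direction is a
standard unit vector that maximizes `⟨G u, u⟩ / ⟨A u, u⟩` (any maximizer may be taken), and the
parameter of the Broyden family is any `φ ∈ [0, 1]`. -/
def IsGBroyd {n : ℕ} (G A G' : Matrix (Fin n) (Fin n) ℝ) : Prop :=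
  ∃ (i : Fin n) (φ : ℝ), (∀ j, greedyQuotient G A j ≤ greedyQuotient G A i) ∧
    0 ≤ φ ∧ φ ≤ 1 ∧ G' = broyd φ G A (Pi.single i 1)

/-- `G'` is a possible result of `τ` successive updates `gBroyd(·, A)` started at `G`. -/
def IsGBroydIter {n : ℕ} (τ : ℕ) (G A G' : Matrix (Fin n) (Fin n) ℝ) : Prop :=
  ∃ H : ℕ → Matrix (Fin n) (Fin n) ℝ, H 0 = G ∧
    (∀ t < τ, IsGBroyd (H t) A (H (t + 1))) ∧ H τ = G'

/-- The error metric `σ_A(G) = ⟨A⁻¹, G - A⟩`. -/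
def errorMetric {n : ℕ} (A G : Matrix (Fin n) (Fin n) ℝ) : ℝ :=
  Matrix.trace (A⁻¹ * (G - A))

/-! ### Constants and the adaptive stepsize -/

/-- `ρ = 1 - 1 / (n κ)`. -/
def rho (n : ℕ) (κ : ℝ) : ℝ := 1 - 1 / (n * κ)

/-- `σ_τ = ρ ^ τ ε + n`. -/
def sigmaTau (n : ℕ) (κ : ℝ) (τ : ℕ) (ε : ℝ) : ℝ := rho n κ ^ τ * ε + n

/-- The constant `c_{τ, ε}`. -/
def cTau (n : ℕ) (κ : ℝ) (τ : ℕ) (ε : ℝ) : ℝ :=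
  - (sigmaTau n κ τ ε / (sigmaTau n κ τ ε + n)) +
    Real.sqrt (rho n κ * sigmaTau n κ τ ε ^ 2
        + (sigmaTau n κ τ ε + n) * (1 - rho n κ ^ (τ + 1)) * ε) /
      (Real.sqrt (rho n κ) * (sigmaTau n κ τ ε + n))

/-- `ε₀ = 1 / (2 κ - 1)`. -/
def eps0 (κ : ℝ) : ℝ := 1 / (2 * κ - 1)

/-- `Φ̄₀ = ε₀ + n ln 2 / (12 n + 2)`. -/
def phiBar0 (n : ℕ) (κ : ℝ) : ℝ := eps0 κ + n * Real.log 2 / (12 * n + 2)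

/-- `β(x) = L ‖∇f(x)‖ / (2 μ²)`. -/
def beta {n : ℕ} (f : EuclideanSpace ℝ (Fin n) → ℝ) (μ L : ℝ)
    (x : EuclideanSpace ℝ (Fin n)) : ℝ :=
  L * ‖gradient f x‖ / (2 * μ ^ 2)

/-- The adaptive stepsize `min {α_τ(x), 1 / (4 β(x)), 1}` with
`α_τ(x) = c_{τ, ε₀} / (M ‖∇f(x)‖_G^*)`. It is only meaningful while `∇f(x) ≠ 0`; at a stationary
point, where the search direction vanishes, its value is immaterial. -/
def stepsize {n : ℕ} (f : EuclideanSpace ℝ (Fin n) → ℝ) (μ ω L M : ℝ) (τ : ℕ)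
    (x : EuclideanSpace ℝ (Fin n)) (G : Matrix (Fin n) (Fin n) ℝ) : ℝ :=
  min (cTau n (ω / μ) τ (eps0 (ω / μ)) / (M * dualNormAt G (gradient f x)))
    (min (1 / (4 * beta f μ L x)) 1)

/-- `(x k, G k)` is a sequence of iterates of the adaptive greedy quasi-Newton method with
parameters `μ, ω, L, M, τ`. -/
structure IsAGQN {n : ℕ} (f : EuclideanSpace ℝ (Fin n) → ℝ) (μ ω L M : ℝ) (τ : ℕ)
    (x : ℕ → EuclideanSpace ℝ (Fin n)) (G : ℕ → Matrix (Fin n) (Fin n) ℝ) : Prop where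
  step : ∀ k, x (k + 1) = x k - stepsize f μ ω L M τ (x k) (G k) •
    WithLp.toLp 2 ((G k)⁻¹ *ᵥ (gradient f (x k)).ofLp)
  update : ∀ k, ∃ Glow : Matrix (Fin n) (Fin n) ℝ,
    IsGBroydIter τ (G k) (hessian f (x k)) Glow ∧
    IsGBroyd ((1 + M * normAt (hessian f (x k)) (x (k + 1) - x k)) • Glow)
      (hessian f (x (k + 1))) (G (k + 1))

end

end AGQN

/-! Put `γ k = L‖∇f(x k)‖/μ²`, `a k = κ σ k` with `σ k` the error metric, `N = nκ`, `r = ρ^(τ+1)`,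
`F = N(N+τ)/τ`. The method reduces to four scalar inequalities. A greedy update preserves `A ⪯ G`
and contracts `σ` by `ρ`, and self-concordance controls the effect of moving `x`: `a (k+1) ≤ r * a k
+ 6N * α k * γ k`. The constant `c_τ` is a step bound that keeps `σ ≤ ε₀`. Then the quasi-Newton
error is at most `71/100` of the gradient and the cap `1/(4β)` tames the Taylor remainder, so `γ
(k+1) ≤ (1 - α k/25) γ k`; a unit step also gives `γ (k+1) ≤ (a k + γ k) γ k`. Finally, a step with
`α k ≠ 1` and `γ k ≠ 0` has `α k * γ k ≥ 1/(9F)`.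

Counting: the decrease gives `∑ α γ ≤ 25 γ 0`, so there are `O(F γ 0)` short steps. Split `a ≤ l^v +
e`, where `l = 1 - 1/(25N)`, `v` counts good steps and `e` is caused by motion. Since `N/(1-r) ≤ F`,
also `∑ e = O(F γ 0)`, so unit steps with `e + 300Nγ > 1` are equally few. On the remaining, good
steps `e + 300Nγ ≤ l^v`, so `γ` shrinks by at most `2 l^v`. Multiplying, `γ ≤ γ 0 *
exp(-v(v-1)/(1000N))`, and `v` of order `√(N W)` suffices (`exists_scalarInvariant`,
`exists_le_of_scalar_recursion`). The number `Φ̄₀` enters only by splitting `log(‖∇f(x 0)‖/ε)` into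
two logarithms. -/

namespace AGQN

/-! ### Quadratic forms, traces and the error metric -/

section LinearAlgebra

variable {n : ℕ} {A B E G : Matrix (Fin n) (Fin n) ℝ}

theorem posSemidef_quad_nonneg (hE : E.PosSemidef) (x : Fin n → ℝ) : 0 ≤ x ⬝ᵥ E *ᵥ x := by
  simpa using hE.dotProduct_mulVec_nonneg x

theorem posSemidef_of_quad (hE : Eᵀ = E) (h : ∀ x : Fin n → ℝ, 0 ≤ x ⬝ᵥ E *ᵥ x) :
    E.PosSemidef :=
  .of_dotProduct_mulVec_nonneg (by simpa [Matrix.IsHermitian] using hE) (by simpa using h)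

theorem posSemidef_transpose (hE : E.PosSemidef) : Eᵀ = E := by
  simpa [Matrix.IsHermitian] using hE.1

theorem dotProduct_mulVec_symm (hE : Eᵀ = E) (x y : Fin n → ℝ) :
    x ⬝ᵥ E *ᵥ y = y ⬝ᵥ E *ᵥ x := by
  rw [Matrix.dotProduct_mulVec, ← Matrix.mulVec_transpose, hE, dotProduct_comm]

theorem Loewner.quad_le (h : Loewner A B) (x : Fin n → ℝ) : x ⬝ᵥ A *ᵥ x ≤ x ⬝ᵥ B *ᵥ x := by
  have := posSemidef_quad_nonneg h x
  rw [Matrix.sub_mulVec, dotProduct_sub] at this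
  linarith

theorem Loewner.trans {D : Matrix (Fin n) (Fin n) ℝ} (h : Loewner A B) (h' : Loewner B D) :
    Loewner A D := by
  have := Matrix.PosSemidef.add h h'
  rwa [sub_add_sub_cancel'] at this

theorem Loewner.posDef (hA : A.PosDef) (h : Loewner A B) : B.PosDef := by
  have := hA.add_posSemidef h
  rwa [add_sub_cancel] at this

/-- The Cauchy–Schwarz inequality for a positive semidefinite form. -/
theorem posSemidef_cauchySchwarz (hE : E.PosSemidef) (x y : Fin n → ℝ) :
    (x ⬝ᵥ E *ᵥ y) ^ 2 ≤ (x ⬝ᵥ E *ᵥ x) * (y ⬝ᵥ E *ᵥ y) := by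
  have h : ∀ t : ℝ, 0 ≤ (y ⬝ᵥ E *ᵥ y) * (t * t) + (2 * (x ⬝ᵥ E *ᵥ y)) * t + x ⬝ᵥ E *ᵥ x := by
    intro t
    have := posSemidef_quad_nonneg hE (x + t • y)
    simp only [Matrix.mulVec_add, Matrix.mulVec_smul, add_dotProduct, dotProduct_add,
      smul_dotProduct, dotProduct_smul, smul_eq_mul] at this
    rw [dotProduct_mulVec_symm (posSemidef_transpose hE) y x] at this
    linarith
  have := discrim_le_zero h
  rw [discrim] at this
  linarith

theorem posDef_mulVec_inv (hA : A.PosDef) (b : Fin n → ℝ) : A *ᵥ (A⁻¹ *ᵥ b) = b := by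
  have := (A.isUnit_iff_isUnit_det).1 hA.isUnit
  rw [Matrix.mulVec_mulVec, Matrix.mul_nonsing_inv _ this, Matrix.one_mulVec]

theorem posDef_inv_mulVec (hA : A.PosDef) (b : Fin n → ℝ) : A⁻¹ *ᵥ (A *ᵥ b) = b := by
  have := (A.isUnit_iff_isUnit_det).1 hA.isUnit
  rw [Matrix.mulVec_mulVec, Matrix.nonsing_inv_mul _ this, Matrix.one_mulVec]

/-- Cauchy–Schwarz for the form `A` at `y` and `A⁻¹ b`. -/
theorem posDef_dual_cauchySchwarz (hA : A.PosDef) (b y : Fin n → ℝ) :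
    (b ⬝ᵥ y) ^ 2 ≤ (b ⬝ᵥ A⁻¹ *ᵥ b) * (y ⬝ᵥ A *ᵥ y) := by
  have h := posSemidef_cauchySchwarz hA.posSemidef y (A⁻¹ *ᵥ b)
  rw [posDef_mulVec_inv hA, dotProduct_comm y b, dotProduct_comm _ b] at h
  linarith

/-- With `y = B⁻¹ b`, dual Cauchy–Schwarz gives `(b·y)² ≤ (b·A⁻¹b)(y·Ay)`, and `y·Ay ≤ y·By = b·y`;
cancel `b·y`. -/
theorem posDef_inv_antitone (hA : A.PosDef) (h : Loewner A B) (b : Fin n → ℝ) :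
    b ⬝ᵥ B⁻¹ *ᵥ b ≤ b ⬝ᵥ A⁻¹ *ᵥ b := by
  have hB := h.posDef hA
  have h1 := posDef_dual_cauchySchwarz hA b (B⁻¹ *ᵥ b)
  have h2 := h.quad_le (B⁻¹ *ᵥ b)
  rw [posDef_mulVec_inv hB, dotProduct_comm _ b] at h2
  have h3 := posSemidef_quad_nonneg hA.inv.posSemidef b
  have h4 := posSemidef_quad_nonneg hB.inv.posSemidef b
  rcases h4.eq_or_lt with h5 | h5
  · rw [← h5]; exact h3
  · by_contra! hlt
    nlinarith [mul_le_mul_of_nonneg_left h2 h3]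

/-- A positive semidefinite matrix is a sum of rank-one matrices, so that the trace of a product
is a sum of values of a quadratic form. -/
theorem posSemidef_exists_sum (hE : E.PosSemidef) :
    ∃ (m : ℕ) (v : Fin m → Fin n → ℝ),
      (∀ P : Matrix (Fin n) (Fin n) ℝ, (P * E).trace = ∑ i, v i ⬝ᵥ P *ᵥ v i) ∧
      ∀ x, x ⬝ᵥ E *ᵥ x = ∑ i, (v i ⬝ᵥ x) ^ 2 := by
  obtain ⟨m, v, hv⟩ := Matrix.posSemidef_iff_eq_sum_vecMulVec.mp hE
  refine ⟨m, v, fun P => ?_, fun x => ?_⟩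
  · rw [hv, Finset.mul_sum, Matrix.trace_sum]
    refine Finset.sum_congr rfl fun i _ => ?_
    rw [Matrix.mul_vecMulVec, Matrix.trace_vecMulVec, star_trivial, dotProduct_comm]
  · rw [hv, Matrix.sum_mulVec, dotProduct_sum]
    refine Finset.sum_congr rfl fun i _ => ?_
    rw [Matrix.vecMulVec_mulVec, star_trivial]
    simp [dotProduct_comm, sq]

theorem trace_mul_mono {P Q : Matrix (Fin n) (Fin n) ℝ} (hE : E.PosSemidef)
    (h : ∀ b : Fin n → ℝ, b ⬝ᵥ P *ᵥ b ≤ b ⬝ᵥ Q *ᵥ b) : (P * E).trace ≤ (Q * E).trace := by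
  obtain ⟨m, v, hv, -⟩ := posSemidef_exists_sum hE
  rw [hv, hv]
  exact Finset.sum_le_sum fun i _ => h _

theorem errorMetric_nonneg (hA : A.PosDef) (h : Loewner A G) : 0 ≤ errorMetric A G := by
  have := trace_mul_mono (P := 0) (Q := A⁻¹) h fun b => by
    simpa using posSemidef_quad_nonneg hA.inv.posSemidef b
  simpa [errorMetric] using this

/-- Write `G - A = ∑ vᵢvᵢᵀ`. Dual Cauchy–Schwarz bounds `(vᵢ·x)²` by `(vᵢ·A⁻¹vᵢ)(x·Ax)`, and the
first factors sum to the trace. -/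
theorem quad_le_errorMetric (hA : A.PosDef) (h : Loewner A G) (x : Fin n → ℝ) :
    x ⬝ᵥ (G - A) *ᵥ x ≤ errorMetric A G * (x ⬝ᵥ A *ᵥ x) := by
  obtain ⟨m, v, hv, hv'⟩ := posSemidef_exists_sum h
  rw [errorMetric, hv, hv', Finset.sum_mul]
  exact Finset.sum_le_sum fun i _ => posDef_dual_cauchySchwarz hA _ _

theorem trace_inv_mul_self (hA : A.PosDef) : (A⁻¹ * A).trace = n := by
  rw [Matrix.nonsing_inv_mul _ ((A.isUnit_iff_isUnit_det).1 hA.isUnit), Matrix.trace_one,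
    Fintype.card_fin]

theorem trace_inv_mul (hA : A.PosDef) : (A⁻¹ * G).trace = errorMetric A G + n := by
  rw [errorMetric, Matrix.mul_sub, Matrix.trace_sub, trace_inv_mul_self hA]
  ring

theorem Loewner.smul_left_trans {t : ℝ} (ht : 0 ≤ t) (h : Loewner A G) (hBA : Loewner B (t • A)) :
    Loewner B (t • G) := by
  refine hBA.trans ?_
  have := Matrix.PosSemidef.smul h ht
  rwa [smul_sub] at this

/-- If `A ⪯ G` and `A ⪯ t B`, the error of `t G` with respect to `B` is controlled by that of `G`
with respect to `A`. -/
theorem errorMetric_smul_le {t : ℝ} (ht : 0 < t) (hA : A.PosDef) (hB : B.PosDef)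
    (h : Loewner A G) (hAB : Loewner A (t • B)) :
    errorMetric B (t • G) ≤ t ^ 2 * (errorMetric A G + n) - n := by
  -- Inverting `A ⪯ t B` gives `B⁻¹ ⪯ t A⁻¹`, to be paired with `G ⪰ 0`.
  have h1 : (B⁻¹ * G).trace ≤ ((t • A⁻¹) * G).trace := by
    refine trace_mul_mono (h.posDef hA).posSemidef fun b => ?_
    have h2 := posDef_inv_antitone hA hAB b
    have h3 : (t • B)⁻¹ = t⁻¹ • B⁻¹ := by
      refine Matrix.inv_eq_left_inv ?_
      rw [Matrix.smul_mul, Matrix.mul_smul, smul_smul, inv_mul_cancel₀ ht.ne', one_smul,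
        Matrix.nonsing_inv_mul _ ((B.isUnit_iff_isUnit_det).1 hB.isUnit)]
    rw [h3, Matrix.smul_mulVec, dotProduct_smul, smul_eq_mul, inv_mul_le_iff₀ ht] at h2
    rwa [Matrix.smul_mulVec, dotProduct_smul, smul_eq_mul]
  rw [Matrix.smul_mul, Matrix.trace_smul, trace_inv_mul hA, smul_eq_mul] at h1
  rw [errorMetric, Matrix.mul_sub, Matrix.mul_smul, Matrix.trace_sub, Matrix.trace_smul,
    trace_inv_mul_self hB, smul_eq_mul]
  nlinarith

end LinearAlgebra

/-! ### Broyden updates and the greedy contraction -/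

section Broyden

variable {n : ℕ} {A G : Matrix (Fin n) (Fin n) ℝ}

theorem dotProduct_mul_vecMulVec_mul_mulVec (P Q : Matrix (Fin n) (Fin n) ℝ)
    (u w x y : Fin n → ℝ) :
    x ⬝ᵥ (P * Matrix.vecMulVec u w * Q) *ᵥ y = (x ⬝ᵥ P *ᵥ u) * (w ⬝ᵥ Q *ᵥ y) := by
  rw [← Matrix.mulVec_mulVec, ← Matrix.mulVec_mulVec, Matrix.vecMulVec_mulVec,
    Matrix.mulVec_smul]
  simp [mul_comm]

theorem trace_mul_mul_vecMulVec_mul (R P Q : Matrix (Fin n) (Fin n) ℝ) (u w : Fin n → ℝ) :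
    (R * (P * Matrix.vecMulVec u w * Q)).trace = w ⬝ᵥ Q *ᵥ (R *ᵥ (P *ᵥ u)) := by
  rw [← Matrix.mul_assoc, ← Matrix.mul_assoc, Matrix.mul_vecMulVec, Matrix.vecMulVec_mul,
    Matrix.trace_vecMulVec, Matrix.dotProduct_mulVec, dotProduct_comm, Matrix.mulVec_mulVec]

/-- Cauchy–Schwarz for `G - A` bounds the subtracted rank-one term. If `u·(G - A)u = 0`, the
convention `1 / 0 = 0` makes that term vanish. -/
theorem sr1_loewner (hA : Aᵀ = A) (h : Loewner A G) (u : Fin n → ℝ) :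
    Loewner A (sr1 G A u) := by
  have hE : (G - A)ᵀ = G - A := posSemidef_transpose h
  have hG : Gᵀ = G := by rw [← sub_add_cancel G A, Matrix.transpose_add, hE, hA]
  refine posSemidef_of_quad ?_ fun x => ?_
  · simp only [sr1, Matrix.transpose_sub, Matrix.transpose_smul, Matrix.transpose_mul,
      Matrix.transpose_vecMulVec, hE, hA, hG, Matrix.mul_assoc]
  · have hcs := posSemidef_cauchySchwarz h x u
    have hx := posSemidef_quad_nonneg h x
    have hu := posSemidef_quad_nonneg h u
    have : x ⬝ᵥ (sr1 G A u - A) *ᵥ x =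
        x ⬝ᵥ (G - A) *ᵥ x - (1 / (u ⬝ᵥ (G - A) *ᵥ u)) * (x ⬝ᵥ (G - A) *ᵥ u) ^ 2 := by
      rw [sr1, sub_right_comm, Matrix.sub_mulVec, dotProduct_sub, Matrix.smul_mulVec,
        dotProduct_smul, dotProduct_mul_vecMulVec_mul_mulVec, dotProduct_mulVec_symm hE u x,
        dotProduct_comm _ u, smul_eq_mul, sq]
    rw [this, sub_nonneg, one_div, mul_comm, ← div_eq_mul_inv]
    exact div_le_of_le_mul₀ hu hx hcs

/-- The form of `dfp G A u - A` at `x` is that of `G - A` at `x - ((x·Au)/(u·Au)) u`. -/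
theorem dfp_loewner (hA : A.PosDef) (h : Loewner A G) {u : Fin n → ℝ} (hu : u ≠ 0) :
    Loewner A (dfp G A u) := by
  have hAt : Aᵀ = A := posSemidef_transpose hA.posSemidef
  have hE : (G - A)ᵀ = G - A := posSemidef_transpose h
  have hG : Gᵀ = G := by rw [← sub_add_cancel G A, Matrix.transpose_add, hE, hAt]
  have ha : 0 < u ⬝ᵥ A *ᵥ u := by simpa using hA.dotProduct_mulVec_pos hu
  refine posSemidef_of_quad ?_ fun x => ?_
  · simp only [dfp, Matrix.transpose_sub, Matrix.transpose_add, Matrix.transpose_smul,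
      Matrix.transpose_mul, Matrix.transpose_vecMulVec, hAt, hG, Matrix.mul_assoc]
    rw [add_comm (G * _) (A * _)]
  · have hy := posSemidef_quad_nonneg h (x - ((x ⬝ᵥ A *ᵥ u) / (u ⬝ᵥ A *ᵥ u)) • u)
    simp only [Matrix.mulVec_sub, Matrix.sub_mulVec, Matrix.mulVec_smul, sub_dotProduct,
      dotProduct_sub, smul_dotProduct, dotProduct_smul, smul_eq_mul] at hy
    simp only [dfp, Matrix.sub_mulVec, Matrix.add_mulVec, Matrix.smul_mulVec, dotProduct_sub,
      dotProduct_add, dotProduct_smul, dotProduct_mul_vecMulVec_mul_mulVec, smul_eq_mul]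
    rw [dotProduct_mulVec_symm hAt u x, dotProduct_mulVec_symm hG u x] at hy ⊢
    rw [dotProduct_comm _ u, dotProduct_comm _ u]
    refine hy.trans_eq ?_
    field_simp
    ring

theorem errorMetric_dfp (hA : A.PosDef) {u : Fin n → ℝ} (hu : u ≠ 0) :
    errorMetric A (dfp G A u) =
      errorMetric A G - (u ⬝ᵥ (G - A) *ᵥ u) / (u ⬝ᵥ A *ᵥ u) := by
  have ha : 0 < u ⬝ᵥ A *ᵥ u := by simpa using hA.dotProduct_mulVec_pos hu
  have h1 : (A⁻¹ * dfp G A u).trace = errorMetric A G + n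
      - 1 / (u ⬝ᵥ A *ᵥ u) * (u ⬝ᵥ G *ᵥ u + u ⬝ᵥ G *ᵥ u)
      + ((u ⬝ᵥ G *ᵥ u) / (u ⬝ᵥ A *ᵥ u) + 1) / (u ⬝ᵥ A *ᵥ u) * (u ⬝ᵥ A *ᵥ u) := by
    rw [dfp, Matrix.mul_add, Matrix.mul_sub, Matrix.mul_smul, Matrix.mul_smul, Matrix.mul_add,
      Matrix.trace_add, Matrix.trace_sub, Matrix.trace_smul, Matrix.trace_smul, Matrix.trace_add,
      trace_mul_mul_vecMulVec_mul, trace_mul_mul_vecMulVec_mul, trace_mul_mul_vecMulVec_mul,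
      trace_inv_mul hA, posDef_inv_mulVec hA, posDef_mulVec_inv hA, dotProduct_comm _ u,
      dotProduct_comm _ u, smul_eq_mul, smul_eq_mul]
  rw [trace_inv_mul hA] at h1
  rw [Matrix.sub_mulVec, dotProduct_sub, eq_sub_of_add_eq h1]
  field_simp
  ring

/-- With `E = G - A`, the trace drops by `(Eu·A⁻¹Eu)/(u·Eu)`, which dual Cauchy–Schwarz bounds below
by `(u·Eu)/(u·Au)`, the exact drop for DFP. -/
theorem errorMetric_sr1_le (hA : A.PosDef) (h : Loewner A G) (u : Fin n → ℝ) (hu : u ≠ 0) :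
    errorMetric A (sr1 G A u) ≤
      errorMetric A G - (u ⬝ᵥ (G - A) *ᵥ u) / (u ⬝ᵥ A *ᵥ u) := by
  have ha : 0 < u ⬝ᵥ A *ᵥ u := by simpa using hA.dotProduct_mulVec_pos hu
  have he := posSemidef_quad_nonneg h u
  have hE : (G - A)ᵀ = G - A := posSemidef_transpose h
  have h1 : errorMetric A (sr1 G A u) = errorMetric A G - (1 / (u ⬝ᵥ (G - A) *ᵥ u)) *
      (((G - A) *ᵥ u) ⬝ᵥ A⁻¹ *ᵥ ((G - A) *ᵥ u)) := by
    rw [errorMetric, sr1, sub_right_comm, Matrix.mul_sub, Matrix.mul_smul, Matrix.trace_sub,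
      Matrix.trace_smul, trace_mul_mul_vecMulVec_mul, ← errorMetric, smul_eq_mul,
      dotProduct_comm ((G - A) *ᵥ u) u, dotProduct_mulVec_symm hE u (A⁻¹ *ᵥ _),
      dotProduct_comm (A⁻¹ *ᵥ _)]
  rw [h1]
  have h2 := posDef_dual_cauchySchwarz hA ((G - A) *ᵥ u) u
  rw [dotProduct_comm _ u] at h2
  refine sub_le_sub_left ?_ _
  rcases he.eq_or_lt with he0 | he0
  · simp [← he0]
  · rw [div_le_iff₀ ha, one_div, mul_assoc, ← div_eq_inv_mul, le_div_iff₀ he0, ← sq]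
    exact h2

theorem broyd_loewner (hA : A.PosDef) (h : Loewner A G) {u : Fin n → ℝ} (hu : u ≠ 0) {φ : ℝ}
    (h0 : 0 ≤ φ) (h1 : φ ≤ 1) : Loewner A (broyd φ G A u) := by
  have := (Matrix.PosSemidef.smul (dfp_loewner hA h hu) h0).add
    (Matrix.PosSemidef.smul (sr1_loewner (posSemidef_transpose hA.posSemidef) h u)
      (sub_nonneg.2 h1))
  rw [Loewner]
  convert this using 1
  rw [broyd, smul_sub, smul_sub, sub_smul 1 φ A, one_smul]
  abel

theorem errorMetric_broyd_le (hA : A.PosDef) (h : Loewner A G) {u : Fin n → ℝ} (hu : u ≠ 0)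
    {φ : ℝ} (h1 : φ ≤ 1) :
    errorMetric A (broyd φ G A u) ≤
      errorMetric A G - (u ⬝ᵥ (G - A) *ᵥ u) / (u ⬝ᵥ A *ᵥ u) := by
  have h2 := errorMetric_sr1_le hA h u hu
  have h3 := errorMetric_dfp (G := G) hA hu
  have : errorMetric A (broyd φ G A u) =
      φ * errorMetric A (dfp G A u) + (1 - φ) * errorMetric A (sr1 G A u) := by
    have : broyd φ G A u - A = φ • (dfp G A u - A) + (1 - φ) • (sr1 G A u - A) := by
      rw [broyd, smul_sub, smul_sub, sub_smul 1 φ A, one_smul]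
      abel
    simp only [errorMetric, this, Matrix.mul_add, Matrix.mul_smul, Matrix.trace_add,
      Matrix.trace_smul, smul_eq_mul]
  rw [this, h3]
  nlinarith [mul_le_mul_of_nonneg_left h2 (sub_nonneg.2 h1)]

theorem quad_single (A : Matrix (Fin n) (Fin n) ℝ) (i : Fin n) :
    (Pi.single i 1 : Fin n → ℝ) ⬝ᵥ A *ᵥ Pi.single i 1 = A i i := by
  simp

/-- One greedy update preserves `A ⪯ G` and contracts the error metric. -/
theorem IsGBroyd.loewner_and_errorMetric_le {G' : Matrix (Fin n) (Fin n) ℝ} {μ ω : ℝ}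
    (hμ : 0 < μ) (hlow : Loewner (μ • 1) A) (hup : Loewner A (ω • 1)) (h : Loewner A G)
    (hG : IsGBroyd G A G') :
    Loewner A G' ∧ errorMetric A G' ≤ rho n (ω / μ) * errorMetric A G := by
  obtain ⟨i, φ, hi, h0, h1, rfl⟩ := hG
  have hA : A.PosDef := hlow.posDef (Matrix.PosDef.one.smul hμ)
  have hu : (Pi.single i 1 : Fin n → ℝ) ≠ 0 := by simp
  refine ⟨broyd_loewner hA h hu h0 h1, (errorMetric_broyd_le hA h hu h1).trans ?_⟩
  have hpos : ∀ j, 0 < A j j := fun j => by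
    have := hA.dotProduct_mulVec_pos (x := Pi.single j 1) (by simp)
    rwa [star_trivial, quad_single] at this
  have hle : ∀ j, A j j ≤ ω := fun j => by
    have := hup.quad_le (Pi.single j 1)
    rw [quad_single, quad_single] at this
    simpa using this
  have hω : 0 < ω := (hpos i).trans_le (hle i)
  have hn : (0 : ℝ) < n := by exact_mod_cast i.pos
  rw [quad_single, quad_single, Matrix.sub_apply]
  -- Subtracting 1 from the greedy quotient shows that `i` also maximizes the relative diagonal
  -- error, which is the guaranteed drop.
  have hq : ∀ j, (G j j - A j j) / A j j ≤ (G i i - A i i) / A i i := fun j => by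
    have := hi j
    rw [greedyQuotient, greedyQuotient, dotProduct_comm, quad_single, dotProduct_comm,
      quad_single, dotProduct_comm, quad_single, dotProduct_comm, quad_single] at this
    rw [sub_div, sub_div, div_self (hpos j).ne', div_self (hpos i).ne']
    linarith
  have hE : ∀ j, 0 ≤ G j j - A j j := fun j => h.diag_nonneg
  -- Bounding every diagonal entry by the maximal relative one costs a factor `nω`; replacing `A⁻¹`
  -- by `μ⁻¹` costs the rest of `nκ`.
  have htr : (G - A).trace ≤ n * (ω * ((G i i - A i i) / A i i)) := by
    rw [Matrix.trace, ← nsmul_eq_mul]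
    have := Finset.sum_le_card_nsmul (Finset.univ : Finset (Fin n)) (fun j => (G - A).diag j)
      (ω * ((G i i - A i i) / A i i)) fun j _ => by
        have h2 := hq j
        have h3 : G j j - A j j = A j j * ((G j j - A j j) / A j j) := by
          field_simp [(hpos j).ne']
        rw [Matrix.diag_apply, Matrix.sub_apply, h3]
        exact mul_le_mul (hle j) h2 (div_nonneg (hE j) (hpos j).le) hω.le
    simpa using this
  have hσ : errorMetric A G ≤ μ⁻¹ * (G - A).trace := by
    have := trace_mul_mono (P := A⁻¹) (Q := (μ • 1 : Matrix (Fin n) (Fin n) ℝ)⁻¹) h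
      fun b => posDef_inv_antitone (Matrix.PosDef.one.smul hμ) hlow b
    have h3 : (μ • 1 : Matrix (Fin n) (Fin n) ℝ)⁻¹ = μ⁻¹ • 1 := by
      refine Matrix.inv_eq_left_inv ?_
      rw [Matrix.smul_mul, Matrix.mul_smul, smul_smul, inv_mul_cancel₀ hμ.ne', one_smul, one_mul]
    rwa [h3, Matrix.smul_mul, one_mul, Matrix.trace_smul, smul_eq_mul] at this
  rw [rho, sub_mul, one_mul]
  refine sub_le_sub_left ?_ _
  rw [one_div, inv_mul_le_iff₀ (by positivity)]
  refine hσ.trans ?_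
  rw [inv_mul_le_iff₀ hμ]
  refine htr.trans_eq ?_
  field_simp

theorem IsGBroydIter.loewner_and_errorMetric_le {G' : Matrix (Fin n) (Fin n) ℝ} {μ ω : ℝ} {τ : ℕ}
    (hμ : 0 < μ) (hρ : 0 ≤ rho n (ω / μ)) (hlow : Loewner (μ • 1) A) (hup : Loewner A (ω • 1))
    (h : Loewner A G) (hG : IsGBroydIter τ G A G') :
    Loewner A G' ∧ errorMetric A G' ≤ rho n (ω / μ) ^ τ * errorMetric A G := by
  obtain ⟨H, rfl, hH, rfl⟩ := hG
  have : ∀ t ≤ τ, Loewner A (H t) ∧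
      errorMetric A (H t) ≤ rho n (ω / μ) ^ t * errorMetric A (H 0) := by
    intro t
    induction t with
    | zero => intro _; simpa using h
    | succ t ih =>
      intro ht
      obtain ⟨h1, h2⟩ := ih (by omega)
      obtain ⟨h3, h4⟩ := (hH t (by omega)).loewner_and_errorMetric_le hμ hlow hup h1
      refine ⟨h3, h4.trans ?_⟩
      rw [pow_succ', mul_assoc]
      exact mul_le_mul_of_nonneg_left h2 hρ
  exact this τ le_rfl

end Broyden

/-! ### The scalar recursion: superlinear rate and step count -/

section Scalar

/-- State of the scalar recursion after `k` steps: `v` counts the good steps, `e` is the part of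
the error caused by the movement of the iterates. -/
def ScalarInvariant (N F g : ℝ) (γ a : ℕ → ℝ) (k v : ℕ) (e : ℝ) : Prop :=
  0 ≤ e ∧ a k ≤ (1 - 1 / (25 * N)) ^ v + e ∧
  (v = 0 ∨ e + 300 * N * γ k ≤ (1 - 1 / (25 * N)) ^ v) ∧
  γ k ≤ g * Real.exp (-(v * (v - 1) / (1000 * N))) ∧
  k ≤ v + 7875 * F * (g - γ k) - F / N * e

/-- On a good step the contraction factor is at most `exp (-t / 20)`. -/
theorem min_two_mul_exp_le {t : ℝ} {θ : ℝ} (h1 : θ ≤ 24 / 25) (h2 : θ ≤ 2 * Real.exp (-t)) :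
    θ ≤ Real.exp (-(t / 20)) := by
  -- At `t = 4/5` the tangent bound `1 - t/20` equals `24/25`; beyond it, `19t/20 ≥ 0.76 > log 2`.
  rcases le_total t (4 / 5) with ht | ht
  · have := Real.add_one_le_exp (-(t / 20))
    linarith
  · refine h2.trans ?_
    have h3 : (2 : ℝ) ≤ Real.exp (19 / 20 * t) := by
      have := Real.log_two_lt_d9
      rw [← Real.log_le_iff_le_exp two_pos]
      linarith
    calc 2 * Real.exp (-t) ≤ Real.exp (19 / 20 * t) * Real.exp (-t) := by gcongr
      _ = Real.exp (-(t / 20)) := by rw [← Real.exp_add]; congr 1; ring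

variable {N F r : ℝ} {γ α a : ℕ → ℝ}

/-- Every step sends `e` to `r e + 6Nαγ`; `v` grows only on good steps, those with `α = 1` and `e +
300Nγ ≤ 1`. Bad steps are paid for by the decrease of `γ`: `7875 = 25 * (9 + 6 + 300)`, for short
steps, the growth of `e`, and unit steps with large `γ`. -/
theorem exists_scalarInvariant (hN : 2 ≤ N) (hr0 : 0 ≤ r) (hr1 : r ≤ 1 - 1 / N)
    (hF : N ≤ F * (1 - r)) (hγ0 : ∀ k, 0 ≤ γ k) (hα0 : ∀ k, 0 ≤ α k)
    (ha0 : a 0 ≤ 1)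
    (hdec : ∀ k, γ (k + 1) ≤ (1 - α k / 25) * γ k)
    (hunit : ∀ k, α k = 1 → γ (k + 1) ≤ (a k + γ k) * γ k)
    (herr : ∀ k, a (k + 1) ≤ r * a k + 6 * N * (α k * γ k))
    (hshort : ∀ k, γ k ≠ 0 → α k ≠ 1 → 1 / (9 * F) ≤ α k * γ k) (k : ℕ) (hk : γ k ≠ 0) :
    ∃ v e, ScalarInvariant N F (γ 0) γ a k v e := by
  have hN0 : 0 < N := by linarith
  have hr : 0 < 1 - r := by linarith [show 0 < 1 / N by positivity]
  have hF0 : 0 < F := by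
    by_contra! h
    nlinarith
  have hFN : N ≤ F := by nlinarith
  set l : ℝ := 1 - 1 / (25 * N) with hl
  have hinv : 1 / (25 * N) ≤ 1 / 50 := by
    apply one_div_le_one_div_of_le <;> linarith
  have hinv0 : 0 < 1 / (25 * N) := by positivity
  have hl0 : 0 < l := by linarith
  have hl1 : l ≤ 1 := by linarith
  have hrl : r ≤ l := by
    have : 1 / (25 * N) ≤ 1 / N := by apply one_div_le_one_div_of_le <;> linarith
    linarith
  induction k with
  | zero => exact ⟨0, 0, le_rfl, by simpa using ha0, Or.inl rfl, by simp, by simp⟩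
  | succ k ih =>
    have hd := hdec k
    have hγk : γ k ≠ 0 := fun h => hk (le_antisymm (by simpa [h] using hd) (hγ0 _))
    obtain ⟨v, e, he, hak, hQ, hexp, hk⟩ := ih hγk
    have hγ : 0 < γ k := (hγ0 k).lt_of_ne' hγk
    rw [← hl] at hak hQ
    have hαγ : 0 ≤ α k * γ k := mul_nonneg (hα0 k) hγ.le
    have hlv : 0 < l ^ v := pow_pos hl0 v
    have he' : 0 ≤ r * e + 6 * N * (α k * γ k) := by positivity
    -- The decay of the potential `(F/N) e` in one step pays for `e`.
    have hFNe : e ≤ F / N * ((1 - r) * e) := by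
      rw [div_mul_eq_mul_div, le_div_iff₀ hN0]
      nlinarith
    have hF1 : 7875 * F * (α k * γ k / 25) ≤ 7875 * F * (γ k - γ (k + 1)) := by
      apply mul_le_mul_of_nonneg_left _ (by positivity)
      linarith
    have hF2 : F / N * (r * e + 6 * N * (α k * γ k)) =
        F / N * e - F / N * ((1 - r) * e) + 6 * F * (α k * γ k) := by
      field_simp
      ring
    by_cases hgood : α k = 1 ∧ e + 300 * N * γ k ≤ 1
    · obtain ⟨h1, hQ1⟩ := hgood
      have hQv : e + 300 * N * γ k ≤ l ^ v := by
        rcases hQ with rfl | hQ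
        · simpa using hQ1
        · exact hQ
      have hu := hunit k h1
      rw [h1] at hd he' hF1 hF2 hαγ
      refine ⟨v + 1, r * e + 6 * N * (1 * γ k), he', ?_, Or.inr ?_, ?_, ?_⟩
      · have := herr k
        rw [h1] at this
        rw [← hl, pow_succ']
        have := mul_le_mul_of_nonneg_left hak hr0
        have := mul_le_mul_of_nonneg_right hrl hlv.le
        linarith
      · rw [← hl, pow_succ']
        have h3 := mul_le_mul_of_nonneg_left hQv hl0.le
        have h4 := mul_le_mul_of_nonneg_right hrl he
        have h5 : 300 * N * γ (k + 1) ≤ 300 * N * ((1 - 1 / 25) * γ k) :=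
          mul_le_mul_of_nonneg_left hd (by positivity)
        -- The gain `6N` and the retained `288N` add up to `294N = (49/50) * 300N`, and `l ≥ 49/50`.
        have h6 : (1 - 1 / 50) * (300 * N * γ k) ≤ l * (300 * N * γ k) :=
          mul_le_mul_of_nonneg_right (by linarith) (by positivity)
        linarith [mul_pos hN0 hγ]
      -- Here `a + γ ≤ l^v + e + γ ≤ 2 l^v`. The exponents `j/(500N)`, `j < v`, sum to
      -- `v(v-1)/(1000N)`.
      · have hθ : γ (k + 1) / γ k ≤ Real.exp (-(v / (25 * N) / 20)) := by
          refine min_two_mul_exp_le ?_ ?_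
          · rw [div_le_iff₀ hγ]; linarith
          · rw [div_le_iff₀ hγ]
            refine hu.trans (mul_le_mul_of_nonneg_right ?_ hγ.le)
            have h7 : l ^ v ≤ Real.exp (-(v / (25 * N))) := by
              have h8 : l ≤ Real.exp (-(1 / (25 * N))) := by
                have := Real.add_one_le_exp (-(1 / (25 * N)))
                linarith
              calc l ^ v ≤ Real.exp (-(1 / (25 * N))) ^ v := by gcongr
                _ = Real.exp (-(v / (25 * N))) := by
                  rw [← Real.exp_nat_mul]; congr 1; ring
            have h9 : γ k ≤ 300 * N * γ k := by
              have := mul_le_mul_of_nonneg_right hN hγ.le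
              linarith
            linarith
        rw [div_le_iff₀ hγ] at hθ
        refine hθ.trans ((mul_le_mul_of_nonneg_left hexp (Real.exp_pos _).le).trans_eq ?_)
        rw [mul_left_comm, ← Real.exp_add]
        congr 2
        push_cast
        field_simp
        ring
      · rw [hF2]
        push_cast
        have := mul_pos hF0 hγ
        linarith
    · refine ⟨v, r * e + 6 * N * (α k * γ k), he', ?_, ?_, ?_, ?_⟩
      · have := herr k
        rw [← hl]
        have := mul_le_mul_of_nonneg_left hak hr0
        have := mul_le_mul_of_nonneg_right hrl hlv.le
        have := mul_le_mul_of_nonneg_right hl1 hlv.le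
        linarith
      · refine hQ.imp_right fun hQ => le_trans ?_ hQ
        have h5 : 300 * N * γ (k + 1) ≤ 300 * N * ((1 - α k / 25) * γ k) :=
          mul_le_mul_of_nonneg_left hd (by positivity)
        -- The loss `12Nαγ` outweighs the gain `6Nαγ` of `e`.
        have h6 : 300 * N * ((1 - α k / 25) * γ k) = 300 * N * γ k - 12 * (N * (α k * γ k)) := by
          ring
        have h7 : r * e ≤ 1 * e := mul_le_mul_of_nonneg_right (hrl.trans hl1) he
        have h8 := mul_nonneg hN0.le hαγ
        linarith
      · refine le_trans ?_ hexp
        linarith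
      · rw [hF2]
        push_cast
        have hFαγ : 0 ≤ F * (α k * γ k) := mul_nonneg hF0.le hαγ
        have h1 : 1 ≤ 9 * F * (α k * γ k) + e + 300 * N * (α k * γ k) := by
          by_cases hα : α k = 1
          · have h2 : 1 < e + 300 * N * γ k := by
              by_contra! h
              exact hgood ⟨hα, h⟩
            rw [hα, one_mul]
            have := hγ
            linarith [mul_pos hF0 this]
          · have := hshort k hγk hα
            rw [div_le_iff₀ (by positivity)] at this
            have h3 : 0 ≤ 300 * N * (α k * γ k) := by positivity
            linarith
        have h4 : N * (α k * γ k) ≤ F * (α k * γ k) := mul_le_mul_of_nonneg_right hFN hαγ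
        linarith

/-- Complexity of the scalar recursion. -/
theorem exists_le_of_scalar_recursion (hN : 2 ≤ N) (hr0 : 0 ≤ r) (hr1 : r ≤ 1 - 1 / N)
    (hF : N ≤ F * (1 - r)) (hγ : ∀ k, 0 ≤ γ k) (hα0 : ∀ k, 0 ≤ α k)
    (ha0 : a 0 ≤ 1)
    (hdec : ∀ k, γ (k + 1) ≤ (1 - α k / 25) * γ k)
    (hunit : ∀ k, α k = 1 → γ (k + 1) ≤ (a k + γ k) * γ k)
    (herr : ∀ k, a (k + 1) ≤ r * a k + 6 * N * (α k * γ k))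
    (hshort : ∀ k, γ k ≠ 0 → α k ≠ 1 → 1 / (9 * F) ≤ α k * γ k)
    {δ W : ℝ} (hδ : 0 < δ) (hW : Real.log 2 ≤ W) (hlog : Real.log (γ 0 / δ) ≤ 2 * W) :
    ∃ k : ℕ, γ k ≤ δ ∧ (k : ℝ) ≤ 8000 * (F * γ 0) + 8000 * (√N * √W) := by
  have hN0 : 0 < N := by linarith
  have hr : 0 < 1 - r := by linarith [show 0 < 1 / N by positivity]
  have hF0 : 0 < F := by
    by_contra! h
    nlinarith
  have hlog2 := Real.log_two_gt_d9
  have hNW : 1 ≤ N * W := by nlinarith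
  have hS : 1 ≤ √N * √W := by
    rw [← Real.sqrt_mul hN0.le]
    exact Real.one_le_sqrt.2 hNW
  have hSsq : (√N * √W) ^ 2 = N * W := by
    rw [← Real.sqrt_mul hN0.le, Real.sq_sqrt (by linarith)]
  set S := √N * √W with hSdef
  have hFγ : 0 ≤ F * γ 0 := mul_nonneg hF0.le (hγ 0)
  -- At most `7875 F γ 0` steps are bad, so at least `100 S` are good; as `S ≥ 1`, this makes the
  -- exponent at least `2W`.
  set m := ⌈8000 * (F * γ 0) + 100 * S⌉₊ with hm
  have hm1 : 8000 * (F * γ 0) + 100 * S ≤ m := Nat.le_ceil _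
  have hm2 : (m : ℝ) < 8000 * (F * γ 0) + 100 * S + 1 := Nat.ceil_lt_add_one (by positivity)
  refine ⟨m, ?_, by linarith⟩
  rcases eq_or_ne (γ m) 0 with hm0 | hm0
  · rw [hm0]
    exact hδ.le
  · obtain ⟨v, e, he, -, -, hexp, hk⟩ := exists_scalarInvariant hN hr0 hr1 hF hγ hα0 ha0
      hdec hunit herr hshort m hm0
    have h1 : 0 ≤ F / N * e := by positivity
    have h2 : 0 ≤ F * γ m := mul_nonneg hF0.le (hγ m)
    have hv : 100 * S ≤ v := by nlinarith
    have hvv : 2000 * (N * W) ≤ v * (v - 1) := by nlinarith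
    refine hexp.trans ?_
    have hpos : 0 < γ 0 := by
      refine (hγ 0).lt_of_ne fun h => hm0 (le_antisymm ?_ (hγ m))
      simpa [← h] using hexp
    have h3 : γ 0 ≤ δ * Real.exp (2 * W) := by
      rw [Real.log_le_iff_le_exp (div_pos hpos hδ), div_le_iff₀ hδ] at hlog
      linarith
    have h4 : Real.exp (-(v * (v - 1) / (1000 * N))) ≤ Real.exp (-(2 * W)) := by
      apply Real.exp_le_exp.2
      rw [neg_le_neg_iff, le_div_iff₀ (by positivity)]
      linarith
    calc γ 0 * Real.exp (-(v * (v - 1) / (1000 * N)))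
        ≤ δ * Real.exp (2 * W) * Real.exp (-(2 * W)) := by
          gcongr
      _ = δ := by rw [mul_assoc, ← Real.exp_add]; simp

end Scalar

/-! ### The constants `ρ`, `σ_τ` and `c_τ` -/

section Constants

variable {n τ : ℕ} {κ : ℝ}

theorem eps0_pos (hκ : 1 ≤ κ) : 0 < eps0 κ := one_div_pos.2 (by linarith)

theorem eps0_le_one (hκ : 1 ≤ κ) : eps0 κ ≤ 1 := by
  rw [eps0, div_le_one (by linarith)]
  linarith

theorem two_le_natCast_mul (hn : 2 ≤ n) (hκ : 1 ≤ κ) : 2 ≤ (n : ℝ) * κ := by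
  have : (2 : ℝ) ≤ n := by exact_mod_cast hn
  nlinarith

theorem half_le_rho (hn : 2 ≤ n) (hκ : 1 ≤ κ) : 1 / 2 ≤ rho n κ := by
  have h := two_le_natCast_mul hn hκ
  have : 1 / (n * κ) ≤ 1 / 2 := one_div_le_one_div_of_le two_pos h
  rw [rho]
  linarith

theorem rho_lt_one (hn : 2 ≤ n) (hκ : 1 ≤ κ) : rho n κ < 1 := by
  have h := two_le_natCast_mul hn hκ
  have : 0 < 1 / (n * κ) := by positivity
  rw [rho]
  linarith

/-- From `ρ(1 + 1/N) ≤ 1` and Bernoulli, `ρ^τ ≤ 1/(1 + τ/N)`. -/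
theorem div_le_one_sub_rho_pow (hn : 2 ≤ n) (hκ : 1 ≤ κ) (τ : ℕ) :
    τ / (n * κ + τ) ≤ 1 - rho n κ ^ (τ + 1) := by
  have hN := two_le_natCast_mul hn hκ
  have hρ := half_le_rho hn hκ
  have hρ1 := rho_lt_one hn hκ
  set N : ℝ := n * κ
  have hN0 : 0 < N := by linarith
  have h1 : rho n κ ^ (τ + 1) ≤ rho n κ ^ τ :=
    pow_le_pow_of_le_one (by linarith) hρ1.le (Nat.le_succ τ)
  have h2 : rho n κ ^ τ * (1 + τ / N) ≤ 1 := by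
    have h3 : 1 + τ / N ≤ (1 + 1 / N) ^ τ := by
      have := one_add_mul_le_pow (a := 1 / N) (by linarith [show 0 < 1 / N by positivity]) τ
      rwa [mul_one_div] at this
    have h4 : rho n κ * (1 + 1 / N) ≤ 1 := by
      have : rho n κ = 1 - 1 / N := rfl
      rw [this]
      nlinarith [sq_nonneg (1 / N)]
    calc rho n κ ^ τ * (1 + τ / N) ≤ rho n κ ^ τ * (1 + 1 / N) ^ τ := by gcongr
      _ = (rho n κ * (1 + 1 / N)) ^ τ := (mul_pow _ _ _).symm
      _ ≤ 1 := pow_le_one₀ (by positivity) h4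
  have h5 : rho n κ ^ τ ≤ N / (N + τ) := by
    rw [le_div_iff₀ (by positivity)]
    have : N + τ = N * (1 + τ / N) := by field_simp
    rw [this]
    nlinarith
  have h6 : N / (N + τ) = 1 - τ / (N + τ) := by field_simp; ring
  linarith

/-- `cTau` is the positive root of a quadratic equation. -/
theorem cTau_quadratic (hn : 2 ≤ n) (hκ : 1 ≤ κ) (τ : ℕ) :
    0 ≤ cTau n κ τ (eps0 κ) ∧
      rho n κ * ((sigmaTau n κ τ (eps0 κ) + n) * cTau n κ τ (eps0 κ) ^ 2 +
        2 * sigmaTau n κ τ (eps0 κ) * cTau n κ τ (eps0 κ)) =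
      (1 - rho n κ ^ (τ + 1)) * eps0 κ := by
  have hρ := half_le_rho hn hκ
  have hρ1 := rho_lt_one hn hκ
  have hε := eps0_pos hκ
  have hn2 : (2 : ℝ) ≤ n := by exact_mod_cast hn
  have hσ : (0 : ℝ) < sigmaTau n κ τ (eps0 κ) := by
    rw [sigmaTau]
    positivity
  have hpow : 0 ≤ (1 - rho n κ ^ (τ + 1)) * eps0 κ :=
    mul_nonneg (sub_nonneg.2 (pow_le_one₀ (by linarith) hρ1.le)) hε.le
  rw [cTau, mul_assoc (_ + _) (1 - _)]
  set σ := sigmaTau n κ τ (eps0 κ)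
  set B := (1 - rho n κ ^ (τ + 1)) * eps0 κ
  set ρ := rho n κ
  have hρ0 : 0 < ρ := by linarith
  have hs : (0 : ℝ) < σ + n := by linarith
  have hq : √(ρ * σ ^ 2 + (σ + n) * B) / (√ρ * (σ + n)) = √(σ ^ 2 + (σ + n) * B / ρ) / (σ + n) := by
    have : ρ * σ ^ 2 + (σ + n) * B = ρ * (σ ^ 2 + (σ + n) * B / ρ) := by field_simp
    rw [this, Real.sqrt_mul hρ0.le, mul_div_mul_left _ _ (Real.sqrt_pos.2 hρ0).ne']
  rw [hq]
  have hR0 : 0 ≤ (σ + n) * B / ρ := by positivity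
  have hR := Real.sq_sqrt (show 0 ≤ σ ^ 2 + (σ + n) * B / ρ by positivity)
  have hRσ : σ ≤ √(σ ^ 2 + (σ + n) * B / ρ) := Real.le_sqrt_of_sq_le (by linarith)
  set R := √(σ ^ 2 + (σ + n) * B / ρ)
  refine ⟨?_, ?_⟩
  · have : -(σ / (σ + n)) + R / (σ + n) = (R - σ) / (σ + n) := by ring
    rw [this]
    exact div_nonneg (by linarith) hs.le
  · have h1 : ρ * ((σ + n) * (-(σ / (σ + n)) + R / (σ + n)) ^ 2 +
        2 * σ * (-(σ / (σ + n)) + R / (σ + n))) = ρ * ((R ^ 2 - σ ^ 2) / (σ + n)) := by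
      field_simp
      ring
    rw [h1, hR]
    field_simp
    ring

theorem sigmaTau_bounds (hn : 2 ≤ n) (hκ : 1 ≤ κ) (τ : ℕ) :
    n ≤ sigmaTau n κ τ (eps0 κ) ∧ sigmaTau n κ τ (eps0 κ) ≤ n + 1 := by
  have hρ := half_le_rho hn hκ
  have hρ1 := rho_lt_one hn hκ
  have hε := eps0_pos hκ
  have hε1 := eps0_le_one hκ
  have h1 : 0 ≤ rho n κ ^ τ := by positivity
  have h2 : rho n κ ^ τ ≤ 1 := pow_le_one₀ (by linarith) hρ1.le
  rw [sigmaTau]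
  constructor <;> nlinarith

theorem cTau_le_half (hn : 2 ≤ n) (hκ : 1 ≤ κ) (τ : ℕ) : cTau n κ τ (eps0 κ) ≤ 1 / 2 := by
  obtain ⟨h0, h⟩ := cTau_quadratic hn hκ τ
  obtain ⟨h1, h2⟩ := sigmaTau_bounds hn hκ τ
  have hρ := half_le_rho hn hκ
  have hn2 : (2 : ℝ) ≤ n := by exact_mod_cast hn
  have hε := eps0_pos hκ
  have hε1 := eps0_le_one hκ
  have hB : (1 - rho n κ ^ (τ + 1)) * eps0 κ ≤ 1 := by
    have : 0 ≤ rho n κ ^ (τ + 1) := by positivity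
    nlinarith
  set c := cTau n κ τ (eps0 κ)
  set σ := sigmaTau n κ τ (eps0 κ)
  have hσ : 0 < σ := by linarith
  have h3 : 0 ≤ (σ + n) * c ^ 2 := by positivity
  have h4 : 4 * c ≤ 2 * σ * c := mul_le_mul_of_nonneg_right (by linarith) h0
  have h5 : 1 / 2 * (4 * c) ≤ rho n κ * ((σ + n) * c ^ 2 + 2 * σ * c) :=
    mul_le_mul hρ (by linarith) (by positivity) (by linarith)
  linarith

/-- Since `c ≤ 1/2` and `n ≤ σ_τ ≤ 3n/2`, the left side of the quadratic equation is at most `(9/2)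
n c`. -/
theorem cTau_lower (hn : 2 ≤ n) (hκ : 1 ≤ κ) (hτ : 1 ≤ τ) :
    1 / (9 * (n * κ * (n * κ + τ) / τ)) ≤ cTau n κ τ (eps0 κ) := by
  obtain ⟨h0, h⟩ := cTau_quadratic hn hκ τ
  obtain ⟨h1, h2⟩ := sigmaTau_bounds hn hκ τ
  have hhalf := cTau_le_half hn hκ τ
  have hρ := half_le_rho hn hκ
  have hρ1 := rho_lt_one hn hκ
  have hn2 : (2 : ℝ) ≤ n := by exact_mod_cast hn
  have hτ1 : (1 : ℝ) ≤ τ := by exact_mod_cast hτ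
  have hB := div_le_one_sub_rho_pow hn hκ τ
  set c := cTau n κ τ (eps0 κ)
  set σ := sigmaTau n κ τ (eps0 κ)
  have hσ : 0 < σ := by linarith
  have h3 : rho n κ * ((σ + n) * c ^ 2 + 2 * σ * c) ≤ 9 / 2 * n * c := by
    have h4 : (σ + n) * c ^ 2 ≤ σ * c := by
      have h5 : (σ + n) * c ≤ σ := by nlinarith
      nlinarith
    have h6 : (σ + n) * c ^ 2 + 2 * σ * c ≤ 9 / 2 * n * c := by nlinarith
    have h7 : 0 ≤ (σ + n) * c ^ 2 + 2 * σ * c := by positivity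
    nlinarith
  have hε : 1 / (2 * κ) ≤ eps0 κ := by
    apply one_div_le_one_div_of_le <;> linarith
  have h8 : τ / (n * κ + τ) * (1 / (2 * κ)) ≤ 9 / 2 * n * c := by
    refine le_trans ?_ h3
    rw [h]
    exact mul_le_mul hB hε (by positivity)
      (sub_nonneg.2 (pow_le_one₀ (by linarith) hρ1.le))
  rw [← div_le_iff₀' (by positivity)] at h8
  refine le_trans (le_of_eq ?_) h8
  field_simp

end Constants

/-! ### The gradient and its Taylor remainder -/

section Calculus

variable {n : ℕ} {f : EuclideanSpace ℝ (Fin n) → ℝ} {μ ω L : ℝ}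

theorem fderiv_gradient_apply (f : EuclideanSpace ℝ (Fin n) → ℝ)
    (x h : EuclideanSpace ℝ (Fin n)) :
    fderiv ℝ (gradient f) x h = WithLp.toLp 2 (hessian f x *ᵥ h.ofLp) := by
  have : fderiv ℝ (gradient f) x = Matrix.toEuclideanCLM (n := Fin n) (𝕜 := ℝ) (hessian f x) := by
    rw [hessian, StarAlgEquiv.apply_symm_apply]
  rw [this]
  rfl

/-- The quadratic remainder bound for the gradient. -/
theorem Assumption.norm_gradient_sub_le (h : Assumption f μ ω L)
    (x v : EuclideanSpace ℝ (Fin n)) :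
    ‖gradient f (x + v) - gradient f x - fderiv ℝ (gradient f) x v‖ ≤ L / 2 * ‖v‖ ^ 2 := by
  have hder : ∀ t : ℝ, HasDerivAt
      (fun s : ℝ => gradient f (x + s • v) - gradient f x - s • fderiv ℝ (gradient f) x v)
      (fderiv ℝ (gradient f) (x + t • v) v - fderiv ℝ (gradient f) x v) t := by
    intro t
    have h1 : HasDerivAt (fun s : ℝ => x + s • v) v t := by
      simpa using ((hasDerivAt_id t).smul_const v).const_add x
    have h2 := (h.differentiable_gradient (x + t • v)).hasFDerivAt.comp_hasDerivAt t h1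
    have h3 : HasDerivAt (fun s : ℝ => s • fderiv ℝ (gradient f) x v)
        (fderiv ℝ (gradient f) x v) t := by
      simpa using (hasDerivAt_id t).smul_const (fderiv ℝ (gradient f) x v)
    exact (h2.sub_const _).sub h3
  have hB : ∀ t : ℝ, HasDerivAt (fun s : ℝ => L / 2 * ‖v‖ ^ 2 * s ^ 2) (L * ‖v‖ ^ 2 * t) t := by
    intro t
    have := (hasDerivAt_pow 2 t).const_mul (L / 2 * ‖v‖ ^ 2)
    refine this.congr_deriv ?_
    norm_num
    ring
  have := image_norm_le_of_norm_deriv_right_le_deriv_boundary (a := 0) (b := 1)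
    (fun t _ => (hder t).continuousAt.continuousWithinAt)
    (fun t _ => (hder t).hasDerivWithinAt) (by simp) hB
    (fun t ht => by
      rw [← _root_.sub_apply]
      refine (ContinuousLinearMap.le_opNorm _ _).trans ?_
      have := h.lipschitz x (x + t • v)
      rw [add_sub_cancel_left, norm_smul, Real.norm_of_nonneg ht.1] at this
      calc _ ≤ L * (t * ‖v‖) * ‖v‖ := by gcongr
        _ = _ := by ring)
    (Set.right_mem_Icc.2 zero_le_one)
  simpa using this

theorem Assumption.posDef (h : Assumption f μ ω L) (x : EuclideanSpace ℝ (Fin n)) :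
    (hessian f x).PosDef :=
  (h.lower x).posDef (Matrix.PosDef.one.smul h.mu_pos)

theorem Assumption.one_le_div (h : Assumption f μ ω L) (hn : 2 ≤ n) : 1 ≤ ω / μ := by
  rw [_root_.one_le_div h.mu_pos]
  have := ((h.lower 0).trans (h.upper 0)).quad_le (Pi.single (⟨0, by omega⟩ : Fin n) 1)
  rw [quad_single, quad_single] at this
  simpa using this

end Calculus

/-! ### Norms of the quasi-Newton direction and its error -/

section Norms

variable {n : ℕ} {A G : Matrix (Fin n) (Fin n) ℝ} {μ ω : ℝ}

theorem dotProduct_self_eq_norm_sq (v : EuclideanSpace ℝ (Fin n)) :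
    v.ofLp ⬝ᵥ v.ofLp = ‖v‖ ^ 2 := by
  rw [EuclideanSpace.real_norm_sq_eq]
  simp [dotProduct, sq]

theorem dotProduct_le_norm_mul (v w : EuclideanSpace ℝ (Fin n)) :
    v.ofLp ⬝ᵥ w.ofLp ≤ ‖v‖ * ‖w‖ := by
  have := real_inner_le_norm w v
  rw [EuclideanSpace.inner_eq_star_dotProduct, star_trivial] at this
  linarith

theorem norm_inv_mulVec_le (hμ : 0 < μ) (h : Loewner (μ • 1) G) (g : EuclideanSpace ℝ (Fin n)) :
    ‖WithLp.toLp 2 (G⁻¹ *ᵥ g.ofLp)‖ ≤ ‖g‖ / μ := by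
  have hG : G.PosDef := h.posDef (Matrix.PosDef.one.smul hμ)
  set d : EuclideanSpace ℝ (Fin n) := WithLp.toLp 2 (G⁻¹ *ᵥ g.ofLp) with hd
  have h1 := h.quad_le d.ofLp
  have h2 : G *ᵥ d.ofLp = g.ofLp := posDef_mulVec_inv hG _
  rw [h2, Matrix.smul_mulVec, Matrix.one_mulVec, dotProduct_smul, smul_eq_mul,
    dotProduct_self_eq_norm_sq] at h1
  have h3 := dotProduct_le_norm_mul d g
  rw [le_div_iff₀ hμ]
  rcases (norm_nonneg d).eq_or_lt with h4 | h4
  · rw [← h4, zero_mul]; exact norm_nonneg g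
  · by_contra! h5
    nlinarith

theorem dual_quad_le (hμ : 0 < μ) (h : Loewner (μ • 1) G) (g : EuclideanSpace ℝ (Fin n)) :
    (G⁻¹ *ᵥ g.ofLp) ⬝ᵥ g.ofLp ≤ ‖g‖ ^ 2 / μ := by
  have h1 := norm_inv_mulVec_le hμ h g
  have h2 := dotProduct_le_norm_mul (WithLp.toLp 2 (G⁻¹ *ᵥ g.ofLp)) g
  refine h2.trans ((mul_le_mul_of_nonneg_right h1 (norm_nonneg g)).trans_eq ?_)
  ring

theorem dualNormAt_le (hμ : 0 < μ) (h : Loewner (μ • 1) G) (g : EuclideanSpace ℝ (Fin n)) :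
    dualNormAt G g ≤ ‖g‖ / √μ := by
  have := Real.sqrt_le_sqrt (dual_quad_le hμ h g)
  rwa [Real.sqrt_div (sq_nonneg _), Real.sqrt_sq (norm_nonneg g)] at this

theorem dualNormAt_pos (hG : G.PosDef) {g : EuclideanSpace ℝ (Fin n)} (hg : g ≠ 0) :
    0 < dualNormAt G g := by
  refine Real.sqrt_pos.2 ?_
  have := hG.inv.dotProduct_mulVec_pos (x := g.ofLp) (by simpa using hg)
  rwa [star_trivial, dotProduct_comm] at this

theorem normAt_neg (A : Matrix (Fin n) (Fin n) ℝ) (v : EuclideanSpace ℝ (Fin n)) :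
    normAt A (-v) = normAt A v := by
  simp [normAt, Matrix.mulVec_neg]

theorem normAt_smul (A : Matrix (Fin n) (Fin n) ℝ) {t : ℝ} (ht : 0 ≤ t)
    (v : EuclideanSpace ℝ (Fin n)) : normAt A (t • v) = t * normAt A v := by
  simp only [normAt, WithLp.ofLp_smul, Matrix.mulVec_smul, smul_dotProduct, dotProduct_smul,
    smul_eq_mul]
  rw [← mul_assoc, Real.sqrt_mul (mul_nonneg ht ht), Real.sqrt_mul_self ht]

theorem normAt_inv_mulVec_le (hG : G.PosDef) (h : Loewner A G) (g : EuclideanSpace ℝ (Fin n)) :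
    normAt A (WithLp.toLp 2 (G⁻¹ *ᵥ g.ofLp)) ≤ dualNormAt G g := by
  refine Real.sqrt_le_sqrt ?_
  have := h.quad_le (G⁻¹ *ᵥ g.ofLp)
  rw [posDef_mulVec_inv hG] at this
  rwa [dotProduct_comm (A *ᵥ _)]

/-- The error `(G - A) G⁻¹ g` of a quasi-Newton step in the Euclidean norm. -/
theorem norm_error_sq_le (hμ : 0 < μ) (hω : 0 ≤ ω) (hlow : Loewner (μ • 1) A)
    (hup : Loewner A (ω • 1)) (h : Loewner A G) (g : EuclideanSpace ℝ (Fin n)) :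
    (1 + errorMetric A G) * ‖WithLp.toLp 2 ((G - A) *ᵥ (G⁻¹ *ᵥ g.ofLp))‖ ^ 2 ≤
      ω / μ * errorMetric A G ^ 2 * ‖g‖ ^ 2 := by
  have hA : A.PosDef := hlow.posDef (Matrix.PosDef.one.smul hμ)
  have hG := h.posDef hA
  have hσ := errorMetric_nonneg hA h
  set σ := errorMetric A G
  set d := G⁻¹ *ᵥ g.ofLp with hd
  set w : EuclideanSpace ℝ (Fin n) := WithLp.toLp 2 ((G - A) *ᵥ d) with hw
  have hE : (G - A)ᵀ = G - A := posSemidef_transpose h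
  have h1 : d ⬝ᵥ (G - A) *ᵥ d ≤ σ * (d ⬝ᵥ A *ᵥ d) := quad_le_errorMetric hA h d
  have h2 : d ⬝ᵥ G *ᵥ d ≤ ‖g‖ ^ 2 / μ := by
    rw [hd, posDef_mulVec_inv hG]
    exact dual_quad_le hμ (hlow.trans h) g
  -- Add `σ (d·(G - A)d)` to both sides of `h1`, using `d·Gd = d·Ad + d·(G - A)d`.
  have h3 : (1 + σ) * (d ⬝ᵥ (G - A) *ᵥ d) ≤ σ * (‖g‖ ^ 2 / μ) := by
    rw [Matrix.sub_mulVec, dotProduct_sub] at h1 ⊢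
    nlinarith
  have h4 : w.ofLp ⬝ᵥ (G - A) *ᵥ w.ofLp ≤ σ * (ω * ‖w‖ ^ 2) := by
    refine (quad_le_errorMetric hA h _).trans (mul_le_mul_of_nonneg_left ?_ hσ)
    have := hup.quad_le w.ofLp
    rwa [Matrix.smul_mulVec, Matrix.one_mulVec, dotProduct_smul, smul_eq_mul,
      dotProduct_self_eq_norm_sq] at this
  have h5 := posSemidef_cauchySchwarz h w.ofLp d
  have h6 : w.ofLp ⬝ᵥ (G - A) *ᵥ d = ‖w‖ ^ 2 := dotProduct_self_eq_norm_sq w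
  have h7 := posSemidef_quad_nonneg h d
  rw [h6] at h5
  have h8 : ‖w‖ ^ 2 ≤ σ * ω * (d ⬝ᵥ (G - A) *ᵥ d) := by
    rcases (sq_nonneg ‖w‖).eq_or_lt with h9 | h9
    · rw [← h9]; positivity
    · by_contra! h10
      nlinarith [mul_le_mul_of_nonneg_right h4 h7]
  calc (1 + σ) * ‖w‖ ^ 2 ≤ (1 + σ) * (σ * ω * (d ⬝ᵥ (G - A) *ᵥ d)) := by gcongr
    _ = σ * ω * ((1 + σ) * (d ⬝ᵥ (G - A) *ᵥ d)) := by ring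
    _ ≤ σ * ω * (σ * (‖g‖ ^ 2 / μ)) := by gcongr
    _ = _ := by ring

theorem norm_error_le (hμ : 0 < μ) (hω : 0 ≤ ω) (hκ : 1 ≤ ω / μ) (hlow : Loewner (μ • 1) A)
    (hup : Loewner A (ω • 1)) (h : Loewner A G) (g : EuclideanSpace ℝ (Fin n)) :
    ‖WithLp.toLp 2 ((G - A) *ᵥ (G⁻¹ *ᵥ g.ofLp))‖ ≤ ω / μ * errorMetric A G * ‖g‖ := by
  have hσ := errorMetric_nonneg (hlow.posDef (Matrix.PosDef.one.smul hμ)) h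
  have h1 := norm_error_sq_le hμ hω hlow hup h g
  refine le_of_sq_le_sq ?_ (by positivity)
  have h2 : ω / μ * (errorMetric A G ^ 2 * ‖g‖ ^ 2) ≤
      ω / μ * (ω / μ * (errorMetric A G ^ 2 * ‖g‖ ^ 2)) :=
    mul_le_mul_of_nonneg_left (le_mul_of_one_le_left (by positivity) hκ) (by positivity)
  nlinarith [mul_nonneg hσ (sq_nonneg ‖WithLp.toLp 2 ((G - A) *ᵥ (G⁻¹ *ᵥ g.ofLp))‖)]

theorem norm_error_le_of_errorMetric_le (hμ : 0 < μ) (hω : 0 ≤ ω) (hκ : 1 ≤ ω / μ)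
    (hlow : Loewner (μ • 1) A) (hup : Loewner A (ω • 1)) (h : Loewner A G)
    (hσ1 : errorMetric A G ≤ eps0 (ω / μ)) (g : EuclideanSpace ℝ (Fin n)) :
    ‖WithLp.toLp 2 ((G - A) *ᵥ (G⁻¹ *ᵥ g.ofLp))‖ ≤ 71 / 100 * ‖g‖ := by
  have hσ := errorMetric_nonneg (hlow.posDef (Matrix.PosDef.one.smul hμ)) h
  have h1 := norm_error_sq_le hμ hω hlow hup h g
  have h2 := hσ1.trans (eps0_le_one hκ)
  rw [eps0, le_div_iff₀ (by linarith)] at hσ1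
  refine le_of_sq_le_sq ?_ (by positivity)
  set σ := errorMetric A G
  set s := ‖WithLp.toLp 2 ((G - A) *ᵥ (G⁻¹ *ᵥ g.ofLp))‖ ^ 2
  -- The bound `σ(2κ - 1) ≤ 1` reads `2κσ ≤ 1 + σ`; multiply by `σ ≤ 1`. Thus the squared ratio is
  -- at most `1/2 < (71/100)²`.
  have h3 : ω / μ * σ ^ 2 ≤ 1 / 2 * (1 + σ) := by nlinarith
  have h4 : (1 + σ) * s ≤ (1 + σ) * (1 / 2 * ‖g‖ ^ 2) := by
    nlinarith [mul_le_mul_of_nonneg_right h3 (sq_nonneg ‖g‖)]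
  have h5 := le_of_mul_le_mul_left h4 (by linarith)
  nlinarith [sq_nonneg ‖g‖]

end Norms

/-! ### One step of the method -/

section Step

variable {n τ : ℕ} {f : EuclideanSpace ℝ (Fin n) → ℝ} {μ ω L M : ℝ}

/-- The dimensionless gradient norm `L ‖∇f(x)‖ / μ ^ 2`. -/
noncomputable def scaledGradient (f : EuclideanSpace ℝ (Fin n) → ℝ) (μ L : ℝ)
    (x : EuclideanSpace ℝ (Fin n)) : ℝ :=
  L * ‖gradient f x‖ / μ ^ 2

/-- The quasi-Newton direction. -/
noncomputable def direction (f : EuclideanSpace ℝ (Fin n) → ℝ) (x : EuclideanSpace ℝ (Fin n))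
    (G : Matrix (Fin n) (Fin n) ℝ) : EuclideanSpace ℝ (Fin n) :=
  WithLp.toLp 2 (G⁻¹ *ᵥ (gradient f x).ofLp)

variable {x : EuclideanSpace ℝ (Fin n)} {G : Matrix (Fin n) (Fin n) ℝ}

theorem scaledGradient_nonneg (h : Assumption f μ ω L) (x : EuclideanSpace ℝ (Fin n)) :
    0 ≤ scaledGradient f μ L x :=
  div_nonneg (mul_nonneg h.L_pos.le (norm_nonneg _)) (sq_nonneg _)

theorem beta_eq (f : EuclideanSpace ℝ (Fin n) → ℝ) (μ L : ℝ) (x : EuclideanSpace ℝ (Fin n)) :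
    beta f μ L x = scaledGradient f μ L x / 2 := by
  rw [beta, scaledGradient, mul_comm 2, div_mul_eq_div_div]

theorem stepsize_nonneg (hn : 2 ≤ n) (h : Assumption f μ ω L) (hM : 0 < M) (τ : ℕ)
    (x : EuclideanSpace ℝ (Fin n)) (G : Matrix (Fin n) (Fin n) ℝ) :
    0 ≤ stepsize f μ ω L M τ x G := by
  have h1 := (cTau_quadratic hn (h.one_le_div hn) τ).1
  have h2 := scaledGradient_nonneg h x
  refine le_min (div_nonneg h1 (mul_nonneg hM.le (Real.sqrt_nonneg _))) (le_min ?_ zero_le_one)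
  rw [beta_eq]
  positivity

theorem stepsize_le_one (f : EuclideanSpace ℝ (Fin n) → ℝ) (μ ω L M : ℝ) (τ : ℕ)
    (x : EuclideanSpace ℝ (Fin n)) (G : Matrix (Fin n) (Fin n) ℝ) :
    stepsize f μ ω L M τ x G ≤ 1 :=
  (min_le_right _ _).trans (min_le_right _ _)

theorem stepsize_mul_scaledGradient_le (h : Assumption f μ ω L) (M : ℝ) (τ : ℕ)
    (x : EuclideanSpace ℝ (Fin n)) (G : Matrix (Fin n) (Fin n) ℝ) :
    stepsize f μ ω L M τ x G * scaledGradient f μ L x ≤ 1 / 2 := by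
  have h1 : stepsize f μ ω L M τ x G ≤ 1 / (4 * (scaledGradient f μ L x / 2)) := by
    rw [← beta_eq]
    exact (min_le_right _ _).trans (min_le_left _ _)
  rcases (scaledGradient_nonneg h x).eq_or_lt with h2 | h2
  · rw [← h2]; norm_num
  · rw [le_div_iff₀ (by positivity)] at h1
    linarith

theorem mul_dualNormAt_le (h : Assumption f μ ω L) (hM : M ≤ L / μ ^ (3 / 2 : ℝ))
    (hG : Loewner (hessian f x) G) :
    M * dualNormAt G (gradient f x) ≤ scaledGradient f μ L x := by
  have hμ := h.mu_pos
  have hL := h.L_pos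
  have h1 := dualNormAt_le hμ ((h.lower x).trans hG) (gradient f x)
  have h2 : μ ^ (3 / 2 : ℝ) = μ * √μ := by
    rw [Real.sqrt_eq_rpow, ← Real.rpow_one_add' hμ.le (by norm_num)]
    norm_num
  rw [h2] at hM
  have hs : 0 < √μ := Real.sqrt_pos.2 hμ
  calc M * dualNormAt G (gradient f x) ≤ L / (μ * √μ) * (‖gradient f x‖ / √μ) :=
        mul_le_mul hM h1 (Real.sqrt_nonneg _) (by positivity)
    _ = scaledGradient f μ L x := by
      have h3 : √μ * √μ = μ := Real.mul_self_sqrt hμ.le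
      rw [scaledGradient, div_mul_div_comm, mul_assoc μ, h3, sq]

/-- Short steps make progress bounded from below. -/
theorem stepsize_mul_scaledGradient_ge (hn : 2 ≤ n) (hτ : 1 ≤ τ) (h : Assumption f μ ω L)
    (hM0 : 0 < M) (hM : M ≤ L / μ ^ (3 / 2 : ℝ)) (hG : Loewner (hessian f x) G)
    (hg : scaledGradient f μ L x ≠ 0) (h1 : stepsize f μ ω L M τ x G ≠ 1) :
    1 / (9 * (n * (ω / μ) * (n * (ω / μ) + τ) / τ)) ≤
      stepsize f μ ω L M τ x G * scaledGradient f μ L x := by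
  have hκ := h.one_le_div hn
  have hc := cTau_lower hn hκ hτ
  have hc2 := cTau_le_half hn hκ τ
  have hc0 := (cTau_quadratic hn hκ τ).1
  refine hc.trans ?_
  have hγ := (scaledGradient_nonneg h x).lt_of_ne' hg
  have hg' : gradient f x ≠ 0 := fun h0 => hg (by simp [scaledGradient, h0])
  have hd := dualNormAt_pos (hG.posDef (h.posDef x)) hg'
  rw [stepsize] at h1 ⊢
  -- If the first cap is active, `αγ ≥ c_τ`; if the cap `1/(4β)` is, `αγ = 1/2 ≥ c_τ`.
  rcases min_choice (cTau n (ω / μ) τ (eps0 (ω / μ)) / (M * dualNormAt G (gradient f x)))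
    (min (1 / (4 * beta f μ L x)) 1) with h2 | h2
  · rw [h2, div_mul_eq_mul_div, le_div_iff₀ (by positivity)]
    exact mul_le_mul_of_nonneg_left (mul_dualNormAt_le h hM hG) hc0
  · rw [h2] at h1 ⊢
    rcases min_choice (1 / (4 * beta f μ L x)) 1 with h3 | h3
    · rw [h3, beta_eq]
      refine hc2.trans (le_of_eq ?_)
      field_simp
      norm_num
    · exact absurd h3 h1

theorem normAt_step (hn : 2 ≤ n) (h : Assumption f μ ω L) (hM0 : 0 < M)
    (hG : Loewner (hessian f x) G) (τ : ℕ) :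
    normAt (hessian f x) (x - stepsize f μ ω L M τ x G • direction f x G - x) ≤
      stepsize f μ ω L M τ x G * dualNormAt G (gradient f x) := by
  have hα := stepsize_nonneg hn h hM0 τ x G
  rw [sub_sub_cancel_left, normAt_neg, normAt_smul _ hα]
  exact mul_le_mul_of_nonneg_left (normAt_inv_mulVec_le (hG.posDef (h.posDef x)) hG _) hα

theorem mul_normAt_step_le (hn : 2 ≤ n) (h : Assumption f μ ω L) (hM0 : 0 < M)
    (hM : M ≤ L / μ ^ (3 / 2 : ℝ)) (hG : Loewner (hessian f x) G) (τ : ℕ) :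
    M * normAt (hessian f x) (x - stepsize f μ ω L M τ x G • direction f x G - x) ≤
      stepsize f μ ω L M τ x G * scaledGradient f μ L x := by
  have hα := stepsize_nonneg hn h hM0 τ x G
  have h1 := mul_le_mul_of_nonneg_left (normAt_step hn h hM0 hG τ) hM0.le
  have h2 := mul_le_mul_of_nonneg_left (mul_dualNormAt_le h hM hG) hα
  linarith

theorem mul_normAt_step_le_cTau (hn : 2 ≤ n) (h : Assumption f μ ω L) (hM0 : 0 < M)
    (hG : Loewner (hessian f x) G) (τ : ℕ) :
    M * normAt (hessian f x) (x - stepsize f μ ω L M τ x G • direction f x G - x) ≤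
      cTau n (ω / μ) τ (eps0 (ω / μ)) := by
  have h1 := mul_le_mul_of_nonneg_left (normAt_step hn h hM0 hG τ) hM0.le
  have hc0 := (cTau_quadratic hn (h.one_le_div hn) τ).1
  have h2 : stepsize f μ ω L M τ x G ≤
      cTau n (ω / μ) τ (eps0 (ω / μ)) / (M * dualNormAt G (gradient f x)) := min_le_left _ _
  have hd : 0 ≤ dualNormAt G (gradient f x) := Real.sqrt_nonneg _
  refine h1.trans ?_
  rcases hd.eq_or_lt with hd | hd
  · rw [← hd]; simpa using hc0
  · rw [le_div_iff₀ (by positivity)] at h2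
    linarith

/-- The basic recursion for the norm of the gradient along a quasi-Newton step. -/
theorem norm_gradient_step_le (h : Assumption f μ ω L) (hG : Loewner (hessian f x) G) {α : ℝ}
    (hα0 : 0 ≤ α) (hα1 : α ≤ 1) :
    ‖gradient f (x - α • direction f x G)‖ ≤ (1 - α) * ‖gradient f x‖ +
      α * ‖WithLp.toLp 2 ((G - hessian f x) *ᵥ (G⁻¹ *ᵥ (gradient f x).ofLp))‖ +
      α ^ 2 * (scaledGradient f μ L x / 2) * ‖gradient f x‖ := by
  have hμ := h.mu_pos
  have hL := h.L_pos
  have h1 := h.norm_gradient_sub_le x (-(α • direction f x G))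
  have h2 : fderiv ℝ (gradient f) x (-(α • direction f x G)) = -(α • gradient f x) +
      α • WithLp.toLp 2 ((G - hessian f x) *ᵥ (G⁻¹ *ᵥ (gradient f x).ofLp)) := by
    rw [map_neg, map_smul, fderiv_gradient_apply, direction, Matrix.sub_mulVec,
      posDef_mulVec_inv (hG.posDef (h.posDef x)), WithLp.toLp_sub, smul_sub, WithLp.toLp_ofLp]
    abel
  rw [← sub_eq_add_neg, h2, norm_neg, norm_smul, Real.norm_of_nonneg hα0] at h1
  set E := WithLp.toLp 2 ((G - hessian f x) *ᵥ (G⁻¹ *ᵥ (gradient f x).ofLp))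
  have h3 : ‖direction f x G‖ ≤ ‖gradient f x‖ / μ := norm_inv_mulVec_le hμ ((h.lower x).trans hG) _
  have h4 : L / 2 * (α * ‖direction f x G‖) ^ 2 ≤
      α ^ 2 * (scaledGradient f μ L x / 2) * ‖gradient f x‖ := by
    calc L / 2 * (α * ‖direction f x G‖) ^ 2 ≤ L / 2 * (α * (‖gradient f x‖ / μ)) ^ 2 := by gcongr
      _ = _ := by rw [scaledGradient]; field_simp
  have h5 : gradient f (x - α • direction f x G) =
      (gradient f (x - α • direction f x G) - gradient f x - (-(α • gradient f x) + α • E)) +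
        ((1 - α) • gradient f x + α • E) := by
    rw [sub_smul, one_smul]
    abel
  rw [h5]
  refine (norm_add_le _ _).trans ?_
  have h6 := norm_add_le ((1 - α) • gradient f x) (α • E)
  rw [norm_smul, norm_smul, Real.norm_of_nonneg hα0, Real.norm_of_nonneg (sub_nonneg.2 hα1)] at h6
  linarith

theorem scaledGradient_step_le (hn : 2 ≤ n) (h : Assumption f μ ω L) (hM0 : 0 < M)
    (hG : Loewner (hessian f x) G)
    (hσ : errorMetric (hessian f x) G ≤ eps0 (ω / μ)) (τ : ℕ) :
    scaledGradient f μ L (x - stepsize f μ ω L M τ x G • direction f x G) ≤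
      (1 - stepsize f μ ω L M τ x G / 25) * scaledGradient f μ L x := by
  have hκ := h.one_le_div hn
  have hα := stepsize_nonneg hn h hM0 τ x G
  have hω : 0 ≤ ω := by
    have := (_root_.one_le_div h.mu_pos).1 hκ
    linarith [h.mu_pos]
  have h1 := norm_gradient_step_le h hG hα (stepsize_le_one f μ ω L M τ x G)
  have h2 := norm_error_le_of_errorMetric_le h.mu_pos hω hκ (h.lower x) (h.upper x) hG hσ
    (gradient f x)
  have h3 := stepsize_mul_scaledGradient_le h M τ x G
  set α := stepsize f μ ω L M τ x G
  have h4 : α ^ 2 * (scaledGradient f μ L x / 2) * ‖gradient f x‖ ≤ α / 4 * ‖gradient f x‖ := by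
    refine mul_le_mul_of_nonneg_right ?_ (norm_nonneg _)
    nlinarith
  -- `1 - α + (71/100)α + α/4 = 1 - α/25`.
  have h5 : ‖gradient f (x - α • direction f x G)‖ ≤ (1 - α / 25) * ‖gradient f x‖ := by
    nlinarith [mul_le_mul_of_nonneg_left h2 hα, mul_nonneg hα (norm_nonneg (gradient f x))]
  have h6 : 0 ≤ L / μ ^ 2 := div_nonneg h.L_pos.le (sq_nonneg _)
  have h7 := mul_le_mul_of_nonneg_left h5 h6
  rw [scaledGradient, scaledGradient, mul_div_right_comm, mul_div_right_comm]
  linarith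

theorem scaledGradient_unit_step_le (hn : 2 ≤ n) (h : Assumption f μ ω L)
    (hG : Loewner (hessian f x) G) (hα : stepsize f μ ω L M τ x G = 1) :
    scaledGradient f μ L (x - stepsize f μ ω L M τ x G • direction f x G) ≤
      (ω / μ * errorMetric (hessian f x) G + scaledGradient f μ L x) *
        scaledGradient f μ L x := by
  have hκ := h.one_le_div hn
  have hω : 0 ≤ ω := by
    have := (_root_.one_le_div h.mu_pos).1 hκ
    linarith [h.mu_pos]
  have h1 := norm_gradient_step_le h hG zero_le_one le_rfl
  have h2 := norm_error_le h.mu_pos hω hκ (h.lower x) (h.upper x) hG (gradient f x)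
  have hγ := scaledGradient_nonneg h x
  rw [hα]
  have h5 : ‖gradient f (x - (1 : ℝ) • direction f x G)‖ ≤
      (ω / μ * errorMetric (hessian f x) G + scaledGradient f μ L x) * ‖gradient f x‖ := by
    nlinarith [mul_nonneg hγ (norm_nonneg (gradient f x))]
  have h6 : 0 ≤ L / μ ^ 2 := div_nonneg h.L_pos.le (sq_nonneg _)
  have h7 := mul_le_mul_of_nonneg_left h5 h6
  have h8 : ∀ y, scaledGradient f μ L y = L / μ ^ 2 * ‖gradient f y‖ := fun y =>
    mul_div_right_comm _ _ _
  rw [h8 (x - _)]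
  refine h7.trans_eq ?_
  rw [mul_left_comm, ← h8]

/-- The update of the Hessian approximation after a move from `x` to `y`. -/
theorem update_loewner_and_errorMetric_le (hn : 2 ≤ n) (h : Assumption f μ ω L)
    (hM0 : 0 < M) (hself : StronglySelfConcordant f M) (hG : Loewner (hessian f x) G)
    {y : EuclideanSpace ℝ (Fin n)} {Glow G' : Matrix (Fin n) (Fin n) ℝ}
    (hlow : IsGBroydIter τ G (hessian f x) Glow)
    (hG' : IsGBroyd ((1 + M * normAt (hessian f x) (y - x)) • Glow) (hessian f y) G') :
    Loewner (hessian f y) G' ∧ errorMetric (hessian f y) G' ≤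
      rho n (ω / μ) * ((1 + M * normAt (hessian f x) (y - x)) ^ 2 *
        (rho n (ω / μ) ^ τ * errorMetric (hessian f x) G + n) - n) := by
  have hκ := h.one_le_div hn
  have hρ := half_le_rho hn hκ
  have hr : 0 ≤ M * normAt (hessian f x) (y - x) := mul_nonneg hM0.le (Real.sqrt_nonneg _)
  -- Both comparisons measure the move at `x`: one keeps the scaled matrix above the new Hessian,
  -- the other bounds the new trace.
  have h1 := hself x y x x
  have h2 := hself y x x y
  rw [← neg_sub y x, normAt_neg] at h2
  set t := M * normAt (hessian f x) (y - x)
  have h1' : Loewner (hessian f y) ((1 + t) • hessian f x) := by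
    rw [Loewner] at h1 ⊢
    convert h1 using 1
    rw [add_smul, one_smul]
    abel
  have h2' : Loewner (hessian f x) ((1 + t) • hessian f y) := by
    rw [Loewner] at h2 ⊢
    convert h2 using 1
    rw [add_smul, one_smul]
    abel
  obtain ⟨h3, h4⟩ := hlow.loewner_and_errorMetric_le h.mu_pos (by linarith) (h.lower x)
    (h.upper x) hG
  have h5 := h3.smul_left_trans (by linarith : 0 ≤ 1 + t) h1'
  obtain ⟨h6, h7⟩ := hG'.loewner_and_errorMetric_le h.mu_pos (h.lower y) (h.upper y) h5
  refine ⟨h6, h7.trans (mul_le_mul_of_nonneg_left ?_ (by linarith))⟩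
  have h8 := errorMetric_smul_le (by linarith) (h.posDef x) (h.posDef y) h3 h2'
  have h9 : (1 + t) ^ 2 * (errorMetric (hessian f x) Glow + n) ≤
      (1 + t) ^ 2 * (rho n (ω / μ) ^ τ * errorMetric (hessian f x) G + n) := by gcongr
  linarith

/-- The bound `ε₀` on the error metric is preserved as long as `t ≤ c_τ`. -/
theorem error_bound_le_eps0 (hn : 2 ≤ n) {κ σ t : ℝ} (hκ : 1 ≤ κ) (hσ : σ ≤ eps0 κ)
    (ht0 : 0 ≤ t) (ht : t ≤ cTau n κ τ (eps0 κ)) :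
    rho n κ * ((1 + t) ^ 2 * (rho n κ ^ τ * σ + n) - n) ≤ eps0 κ := by
  obtain ⟨h0, h1⟩ := cTau_quadratic hn hκ τ
  have h2 := (sigmaTau_bounds hn hκ τ).1
  have hρ := half_le_rho hn hκ
  set c := cTau n κ τ (eps0 κ)
  set s := sigmaTau n κ τ (eps0 κ) with hs
  have h3 : (1 + t) ^ 2 * (rho n κ ^ τ * σ + n) ≤ (1 + c) ^ 2 * s := by
    have h4 : rho n κ ^ τ * σ + n ≤ s := by
      rw [hs, sigmaTau]
      gcongr
    have h5 : (0 : ℝ) ≤ s := le_trans (Nat.cast_nonneg n) h2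
    calc (1 + t) ^ 2 * (rho n κ ^ τ * σ + n) ≤ (1 + t) ^ 2 * s := by gcongr
      _ ≤ (1 + c) ^ 2 * s := by gcongr
  -- The term `n c²` is slack; it is added to match the quadratic equation of `c_τ`.
  have h6 : (1 + c) ^ 2 * s - n ≤ (s + n) * c ^ 2 + 2 * s * c + rho n κ ^ τ * eps0 κ := by
    have : rho n κ ^ τ * eps0 κ = s - n := by rw [hs, sigmaTau]; ring
    have h7 : 0 ≤ (n : ℝ) * c ^ 2 := by positivity
    rw [this]
    linarith
  calc rho n κ * ((1 + t) ^ 2 * (rho n κ ^ τ * σ + n) - n)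
      ≤ rho n κ * ((s + n) * c ^ 2 + 2 * s * c + rho n κ ^ τ * eps0 κ) := by
        gcongr
        linarith
    _ = eps0 κ := by
      rw [mul_add, h1, pow_succ]
      ring

/-- With `p = ρ^τ`, the motion contributes `ρ(2t + t²)(pσ + n)`; `t ≤ 1/2` and `pσ ≤ 1 ≤ n/2` bound
this by `(15/4) n t`. -/
theorem error_bound_linear (hn : 2 ≤ n) {κ σ t : ℝ} (hκ : 1 ≤ κ) (hσ0 : 0 ≤ σ)
    (hσ : σ ≤ eps0 κ) (ht0 : 0 ≤ t) (ht : t ≤ 1 / 2) :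
    rho n κ * ((1 + t) ^ 2 * (rho n κ ^ τ * σ + n) - n) ≤ rho n κ ^ (τ + 1) * σ + 6 * n * t := by
  have hρ := half_le_rho hn hκ
  have hρ1 := rho_lt_one hn hκ
  have hn2 : (2 : ℝ) ≤ n := by exact_mod_cast hn
  have hσ1 := hσ.trans (eps0_le_one hκ)
  have h1 : rho n κ ^ τ ≤ 1 := pow_le_one₀ (by linarith) hρ1.le
  have h2 : 0 ≤ rho n κ ^ τ := by positivity
  rw [pow_succ' (rho n κ) τ]
  set p := rho n κ ^ τ
  have h3 : p * σ + n ≤ 3 / 2 * n := by nlinarith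
  have h4 : 2 * t + t ^ 2 ≤ 5 / 2 * t := by nlinarith
  have h5 : (2 * t + t ^ 2) * (p * σ + n) ≤ 5 / 2 * t * (3 / 2 * n) := by
    apply mul_le_mul h4 h3 <;> positivity
  have h6 : rho n κ * ((2 * t + t ^ 2) * (p * σ + n)) ≤ 1 * (5 / 2 * t * (3 / 2 * n)) := by
    apply mul_le_mul hρ1.le h5 <;> positivity
  have h7 : 0 ≤ n * t := by positivity
  linarith

end Step

/-! ### Whole runs -/

section Run

variable {n τ : ℕ} {f : EuclideanSpace ℝ (Fin n) → ℝ} {μ ω L M : ℝ}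
  {x : ℕ → EuclideanSpace ℝ (Fin n)} {G : ℕ → Matrix (Fin n) (Fin n) ℝ}

theorem IsAGQN.step_eq (hrun : IsAGQN f μ ω L M τ x G) (k : ℕ) :
    x (k + 1) = x k - stepsize f μ ω L M τ (x k) (G k) • direction f (x k) (G k) :=
  hrun.step k

/-- Along a run, the Hessian approximations stay above the Hessian and within `ε₀` of it. -/
theorem IsAGQN.loewner_and_errorMetric_le (hrun : IsAGQN f μ ω L M τ x G) (hn : 2 ≤ n)
    (h : Assumption f μ ω L) (hM0 : 0 < M) (hself : StronglySelfConcordant f M)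
    (hG0 : Loewner (hessian f (x 0)) (G 0))
    (hσ0 : errorMetric (hessian f (x 0)) (G 0) ≤ eps0 (ω / μ)) (k : ℕ) :
    Loewner (hessian f (x k)) (G k) ∧
      errorMetric (hessian f (x k)) (G k) ≤ eps0 (ω / μ) := by
  induction k with
  | zero => exact ⟨hG0, hσ0⟩
  | succ k ih =>
    obtain ⟨hG, hσ⟩ := ih
    obtain ⟨Glow, hlow, hup⟩ := hrun.update k
    obtain ⟨h1, h2⟩ := update_loewner_and_errorMetric_le hn h hM0 hself hG hlow hup
    refine ⟨h1, h2.trans (error_bound_le_eps0 hn (h.one_le_div hn) hσ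
      (mul_nonneg hM0.le (Real.sqrt_nonneg _)) ?_)⟩
    rw [hrun.step_eq k]
    exact mul_normAt_step_le_cTau hn h hM0 hG τ

/-- Iteration complexity of the adaptive greedy quasi-Newton method. -/
theorem IsAGQN.exists_norm_gradient_le (hrun : IsAGQN f μ ω L M τ x G) (hn : 2 ≤ n) (hτ : 1 ≤ τ)
    (h : Assumption f μ ω L) (hM0 : 0 < M) (hM : M ≤ L / μ ^ (3 / 2 : ℝ))
    (hself : StronglySelfConcordant f M)
    (hG0 : Loewner (hessian f (x 0)) (G 0))
    (hσ0 : errorMetric (hessian f (x 0)) (G 0) ≤ eps0 (ω / μ)) {ε W : ℝ} (hε : 0 < ε)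
    (hW : Real.log 2 ≤ W) (hlog : Real.log (‖gradient f (x 0)‖ / ε) ≤ 2 * W) :
    ∃ k : ℕ, ‖gradient f (x k)‖ ≤ ε ∧
      (k : ℝ) ≤ 8000 * (n * L * (ω / μ * n + τ) * (ω / μ) / (μ ^ 2 * τ) * ‖gradient f (x 0)‖)
        + 8000 * (√(min (4 * n * (ω / μ) / 3) (n * (ω / μ) + τ)) * √W) := by
  have hκ := h.one_le_div hn
  have hμ := h.mu_pos
  have hL := h.L_pos
  have hρ := half_le_rho hn hκ
  have hρ1 := rho_lt_one hn hκ
  have hN := two_le_natCast_mul hn hκ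
  have hn2 : (2 : ℝ) ≤ n := by exact_mod_cast hn
  have hτ1 : (1 : ℝ) ≤ τ := by exact_mod_cast hτ
  have inv := hrun.loewner_and_errorMetric_le hn h hM0 hself hG0 hσ0
  have hσ : ∀ k, 0 ≤ errorMetric (hessian f (x k)) (G k) := fun k =>
    errorMetric_nonneg (h.posDef _) (inv k).1
  have hpow : rho n (ω / μ) ^ (τ + 1) ≤ 1 - 1 / (n * (ω / μ)) :=
    pow_le_of_le_one (by linarith) hρ1.le (Nat.succ_ne_zero τ)
  have hF : n * (ω / μ) ≤
      n * (ω / μ) * (n * (ω / μ) + τ) / τ * (1 - rho n (ω / μ) ^ (τ + 1)) := by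
    have h1 := div_le_one_sub_rho_pow hn hκ τ
    have h2 : 0 < n * (ω / μ) * (n * (ω / μ) + τ) / τ := by positivity
    refine le_trans (le_of_eq ?_) (mul_le_mul_of_nonneg_left h1 h2.le)
    generalize (n : ℝ) * (ω / μ) = N at hN
    field_simp
  -- The factor `κ` in `a` turns `6n` into `6N`, and `a 0 ≤ κ ε₀ = κ/(2κ - 1) ≤ 1`.
  obtain ⟨k, hk, hk'⟩ := exists_le_of_scalar_recursion
    (γ := fun k => scaledGradient f μ L (x k))
    (α := fun k => stepsize f μ ω L M τ (x k) (G k))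
    (a := fun k => ω / μ * errorMetric (hessian f (x k)) (G k))
    (δ := L * ε / μ ^ 2) (W := W) hN (by positivity) hpow hF
    (fun k => scaledGradient_nonneg h _) (fun k => stepsize_nonneg hn h hM0 τ _ _)
    (by
      have h1 := mul_le_mul_of_nonneg_left hσ0 (by linarith : 0 ≤ ω / μ)
      refine h1.trans ?_
      rw [eps0, mul_one_div, div_le_one (by linarith)]
      linarith)
    (fun k => by
      rw [hrun.step_eq k]
      exact scaledGradient_step_le hn h hM0 (inv k).1 (inv k).2 τ)
    (fun k hα => by
      rw [hrun.step_eq k]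
      exact scaledGradient_unit_step_le hn h (inv k).1 hα)
    (fun k => by
      obtain ⟨Glow, hlow, hup⟩ := hrun.update k
      have h2 := (update_loewner_and_errorMetric_le hn h hM0 hself (inv k).1 hlow hup).2
      have h3 : 0 ≤ M * normAt (hessian f (x k)) (x (k + 1) - x k) :=
        mul_nonneg hM0.le (Real.sqrt_nonneg _)
      have h4 := mul_normAt_step_le hn h hM0 hM (inv k).1 τ
      rw [← hrun.step_eq k] at h4
      have h5 := h4.trans (stepsize_mul_scaledGradient_le h M τ (x k) (G k))
      have h6 := h2.trans (error_bound_linear hn hκ (hσ k) (inv k).2 h3 h5)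
      have h7 : errorMetric (hessian f (x (k + 1))) (G (k + 1)) ≤
          rho n (ω / μ) ^ (τ + 1) * errorMetric (hessian f (x k)) (G k) +
          6 * n * (stepsize f μ ω L M τ (x k) (G k) * scaledGradient f μ L (x k)) :=
        h6.trans (by gcongr)
      have h8 := mul_le_mul_of_nonneg_left h7 (by linarith : 0 ≤ ω / μ)
      linarith)
    (fun k hγ hα => stepsize_mul_scaledGradient_ge hn hτ h hM0 hM (inv k).1 hγ hα)
    (by positivity) hW
    (by
      have : scaledGradient f μ L (x 0) / (L * ε / μ ^ 2) = ‖gradient f (x 0)‖ / ε := by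
        rw [scaledGradient]
        field_simp
      rwa [this])
  refine ⟨k, ?_, hk'.trans (add_le_add (le_of_eq ?_) ?_)⟩
  · rw [scaledGradient, div_le_div_iff_of_pos_right (by positivity)] at hk
    exact le_of_mul_le_mul_left hk hL
  · rw [scaledGradient]
    field_simp
  -- Both entries of the minimum are at least `nκ`.
  · gcongr
    apply le_min <;> linarith

end Run

end AGQN

/-! ### Conclusion: the two logarithmic bounds -/

theorem mainTheorem5 :
    ∃ C : ℝ, 0 < C ∧
      ∀ (n τ : ℕ), 2 ≤ n → 1 ≤ τ →
      ∀ (f : EuclideanSpace ℝ (Fin n) → ℝ) (μ ω L M : ℝ),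
        AGQN.Assumption f μ ω L →
        0 < M → M ≤ L / μ ^ (3 / 2 : ℝ) → AGQN.StronglySelfConcordant f M →
      ∀ (x : ℕ → EuclideanSpace ℝ (Fin n)) (G : ℕ → Matrix (Fin n) (Fin n) ℝ),
        AGQN.Loewner (AGQN.hessian f (x 0)) (G 0) →
        AGQN.errorMetric (AGQN.hessian f (x 0)) (G 0) ≤ AGQN.eps0 (ω / μ) →
        AGQN.IsAGQN f μ ω L M τ x G →
      (∀ ε : ℝ, 0 < ε → ε ≤ AGQN.phiBar0 n (ω / μ) / 2 →
        ε * ‖gradient f (x 0)‖ ≤ AGQN.phiBar0 n (ω / μ) ^ 2 →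
        ∃ k : ℕ, ‖gradient f (x k)‖ ≤ ε ∧
          (k : ℝ) ≤
            C * (n * L * (ω / μ * n + τ) * (ω / μ) / (μ ^ 2 * τ) * ‖gradient f (x 0)‖)
            + C * (Real.sqrt (min (4 * n * (ω / μ) / 3) (n * (ω / μ) + τ))
                * Real.sqrt (Real.log (AGQN.phiBar0 n (ω / μ) / ε)))) ∧
      (∀ ε : ℝ, 0 < ε →
        ∃ k : ℕ, ‖gradient f (x k)‖ ≤ ε ∧
          (k : ℝ) ≤
            C * (n * L * (ω / μ * n + τ) * (ω / μ) / (μ ^ 2 * τ) * ‖gradient f (x 0)‖)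
            + C * (Real.sqrt (min (4 * n * (ω / μ) / 3) (n * (ω / μ) + τ))
                * Real.sqrt (max (Real.log 2) (max (Real.log (AGQN.phiBar0 n (ω / μ) / ε))
                    (Real.log (‖gradient f (x 0)‖ / AGQN.phiBar0 n (ω / μ))))))) := by
  refine ⟨8000, by norm_num, ?_⟩
  intro n τ hn hτ f μ ω L M h hM0 hM hself x G hG0 hσ0 hrun
  have hΦ : 0 < AGQN.phiBar0 n (ω / μ) :=
    add_pos_of_pos_of_nonneg (AGQN.eps0_pos (h.one_le_div hn))
      (div_nonneg (mul_nonneg (Nat.cast_nonneg n) (Real.log_nonneg one_le_two)) (by positivity))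
  have hsplit : ∀ ε : ℝ, 0 < ε → ‖gradient f (x 0)‖ ≠ 0 →
      Real.log (‖gradient f (x 0)‖ / ε) = Real.log (AGQN.phiBar0 n (ω / μ) / ε) +
        Real.log (‖gradient f (x 0)‖ / AGQN.phiBar0 n (ω / μ)) := fun ε hε hg => by
    rw [Real.log_div hg hε.ne', Real.log_div hΦ.ne' hε.ne', Real.log_div hg hΦ.ne']
    ring
  refine ⟨fun ε hε hε1 hε2 => ?_, fun ε hε => ?_⟩
  -- `ε ≤ Φ̄₀/2` gives `W ≥ log 2`, and `ε‖∇f(x 0)‖ ≤ Φ̄₀²` says that `log(Φ̄₀/ε)` dominates the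
  -- other logarithm.
  · have hW : Real.log 2 ≤ Real.log (AGQN.phiBar0 n (ω / μ) / ε) :=
      Real.log_le_log two_pos (by rw [le_div_iff₀ hε]; linarith)
    refine hrun.exists_norm_gradient_le hn hτ h hM0 hM hself hG0 hσ0 hε hW ?_
    rcases (norm_nonneg (gradient f (x 0))).eq_or_lt with hg | hg
    · rw [← hg, zero_div, Real.log_zero]
      linarith [Real.log_nonneg one_le_two]
    · rw [hsplit ε hε hg.ne', two_mul]
      refine add_le_add_right (Real.log_le_log (by positivity) ?_) _
      rw [div_le_div_iff₀ hΦ hε]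
      linarith
  · refine hrun.exists_norm_gradient_le hn hτ h hM0 hM hself hG0 hσ0 hε (le_max_left _ _) ?_
    -- For a zero gradient `Real.log 0 = 0 < log 2`, so the last entry leaves the maximum unchanged.
    rcases (norm_nonneg (gradient f (x 0))).eq_or_lt with hg | hg
    · rw [← hg, zero_div, Real.log_zero]
      exact mul_nonneg zero_le_two ((Real.log_nonneg one_le_two).trans (le_max_left _ _))
    · rw [hsplit ε hε hg.ne', two_mul]
      exact add_le_add ((le_max_left _ _).trans (le_max_right _ _))
        ((le_max_right _ _).trans (le_max_right _ _))
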